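/- Let $K$ be a field and let $A=\bigoplus_{i\ge 0}A_i$ be a (not necessarily commutative) graded $K$-algebra with $A_0=K$ and $\dim_K A_i<\infty$ for all $i$. Put $\mathfrak m=\bigoplus_{i>0}A_i$ and regard $K=A/\mathfrak m$ as a graded left $A$-module. Assume that $A$ is Koszul, i.e. that $K$ has a graded free resolution of the form $$\cdots\to A(-i)^{\beta_i}\to\cdots\to A(-1)^{\beta_1}\to A^{\beta_0}\to K\to 0$$ with natural numbers $\beta_i$. Let $A^!=\bigoplus_{n\ge 0}\operatorname{Ext}^n_A(K,K)$ be its Koszul dual, a graded ring under the Yoneda product $f\cdot g=f\circ g$. For a finitely generated $\mathbb Z$-graded left $A$-module $M$ let $P_\bullet$ be its minimal graded free resolution, that is, the (unique up to isomorphism) graded free resolution with $\partial P_{i+1}\subseteq\mathfrak m P_i$ for all $i\ge 0$. Let $\operatorname{lin}(P_\bullet)$ be the complex with the same terms whose differentials are obtained by replacing with $0$ all entries of degree $\ge 2$ in the matrices of the differentials of $P_\bullet$, and let $$\operatorname{ld}_A(M)=\sup\{\,i\mid H_i(\operatorname{lin}(P_\bullet))\ne 0\,\}$$ be the linearity defect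 of $M$ (with $\sup\emptyset=-\infty$). If $\operatorname{ld}_A(M)<\infty$ for every finitely generated $\mathbb Z$-graded left $A$-module $M$, then $A^!$ is left graded coherent, i.e. every finitely generated graded left ideal of $A^!$ is finitely presented. Moreover, the full subcategory of finitely presented modules in the category of $\mathbb Z$-graded left $A^!$-modules (with morphisms the linear maps of degree $0$) is then an abelian category, and its inclusion into the category of all graded left $A^!$-modules preserves finite limits and finite colimits. -/

import Mathlib

open CategoryTheory CategoryTheory.Limits CategoryTheory.Abelian
open scoped DirectSum

universe v u

namespace KoszulLD

noncomputable section

/-! ## Graded modules over an `ℕ`-graded (noncommutative) ring -/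

section GradedModules

variable {R : Type u} {σ : Type v} [Ring R] [SetLike σ R] [AddSubgroupClass σ R]

/-- A `ℤ`-graded left module `M = ⨁ j, M_j` over the `ℕ`-graded ring `R = ⨁ i, R_i`. -/
structure GrMod (𝓡 : ℕ → σ) where
  carrier : Type u
  [addCommGroup : AddCommGroup carrier]
  [module : Module R carrier]
  /-- the homogeneous components -/
  deg : ℤ → AddSubgroup carrier
  isInternal : DirectSum.IsInternal deg
  smul_mem : ∀ {i : ℕ} {j : ℤ} {r : R} {m : carrier},
    r ∈ 𝓡 i → m ∈ deg j → r • m ∈ deg (i + j)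

attribute [instance] GrMod.addCommGroup GrMod.module

variable {𝓡 : ℕ → σ}

/-- The additive group of `R`-linear maps of degree zero between graded modules. -/
def GrMod.homs (M N : GrMod 𝓡) : AddSubgroup (M.carrier →ₗ[R] N.carrier) where
  carrier := {f | ∀ (j : ℤ) (m : M.carrier), m ∈ M.deg j → f m ∈ N.deg j}
  add_mem' hf hg j m hm := add_mem (hf j m hm) (hg j m hm)
  zero_mem' j _ _ := (N.deg j).zero_mem
  neg_mem' hf j m hm := neg_mem (hf j m hm)

/-- The category of graded left modules and linear maps of degree zero. -/
instance : Category (GrMod 𝓡) where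
  Hom M N := GrMod.homs M N
  id M := ⟨LinearMap.id, fun _ _ hm => hm⟩
  comp f g := ⟨g.1 ∘ₗ f.1, fun j m hm => g.2 j _ (f.2 j m hm)⟩

instance : Preadditive (GrMod 𝓡) where
  homGroup M N := inferInstanceAs (AddCommGroup (GrMod.homs M N))
  add_comp _ _ _ f f' g := Subtype.ext (LinearMap.comp_add f.1 f'.1 g.1)
  comp_add _ _ _ f g g' := Subtype.ext (LinearMap.add_comp f.1 g'.1 g.1)

variable (𝓡) in
/-- The finitely presented graded left modules. -/
def isFP : ObjectProperty (GrMod 𝓡) := fun M => Module.FinitePresentation R M.carrier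

/-- `R` is left graded coherent: each finitely generated graded left ideal (an `Ideal` is a left
ideal) has a finite presentation. -/
def IsLeftGradedCoherent (𝓡 : ℕ → σ) [GradedRing 𝓡] : Prop :=
  ∀ I : Ideal R, I.IsHomogeneous 𝓡 → I.FG → Module.FinitePresentation R I

end GradedModules

/-! ## Graded free resolutions, Koszulness and the linearity defect -/

section Resolutions

variable {R : Type u} {σ : Type v} [Ring R] [SetLike σ R] [AddSubgroupClass σ R]

/-- `r` is homogeneous of degree `n`, where `R_n = 0` for negative `n`. -/
def IsHomogeneousOfDegree (𝓡 : ℕ → σ) (n : ℤ) (r : R) : Prop :=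
  r = 0 ∨ ∃ k : ℕ, (k : ℤ) = n ∧ r ∈ 𝓡 k

/-- A graded free resolution `⋯ → P₂ → P₁ → P₀ → M → 0`, where `P_i = ⨁ s, R(- d_{i,s})` is the
free left module on a set `ι i` of homogeneous generators, the generator `s` having
degree `d_{i,s} = deg i s`. -/
structure GradedFreeResolution {𝓡 : ℕ → σ} (M : GrMod 𝓡) where
  ι : ℕ → Type u
  deg : (i : ℕ) → ι i → ℤ
  d : (i : ℕ) → (ι (i + 1) →₀ R) →ₗ[R] (ι i →₀ R)
  aug : (ι 0 →₀ R) →ₗ[R] M.carrier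
  /-- the differentials preserve degrees: the entries of their matrices are homogeneous -/
  d_homogeneous : ∀ (i : ℕ) (s : ι (i + 1)) (t : ι i),
    IsHomogeneousOfDegree 𝓡 (deg (i + 1) s - deg i t) (d i (Finsupp.single s 1) t)
  aug_homogeneous : ∀ s : ι 0, aug (Finsupp.single s 1) ∈ M.deg (deg 0 s)
  exact_d : ∀ i, Function.Exact (d (i + 1)) (d i)
  exact_aug : Function.Exact (d 0) aug
  aug_surjective : Function.Surjective aug

variable {𝓡 : ℕ → σ} [GradedRing 𝓡]

namespace GradedFreeResolution

variable {M : GrMod 𝓡} (P : GradedFreeResolution M)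

/-- Minimality: `∂ P_{i+1} ⊆ 𝔪 P_i`, that is, all matrix entries lie in `𝔪 = ⨁_{i > 0} R_i`. -/
def IsMinimal : Prop :=
  ∀ (i : ℕ) (s : P.ι (i + 1)) (t : P.ι i),
    P.d i (Finsupp.single s 1) t ∈ (HomogeneousIdeal.irrelevant 𝓡).toIdeal

/-- The differential `P_{i+1} → P_i` of the linear part `lin(P)`: all entries of degree `≥ 2` of
the matrix of `P.d i` are replaced by zero. -/
def lin (i : ℕ) : (P.ι (i + 1) →₀ R) →ₗ[R] (P.ι i →₀ R) :=
  Finsupp.linearCombination R fun s : P.ι (i + 1) =>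
    (P.d i (Finsupp.single s 1)).filter fun t => P.deg (i + 1) s - P.deg i t < 2

/-- `H_i(lin(P)) ≠ 0`, i.e. not every `i`-cycle is a boundary (every `0`-chain is a cycle). -/
def LinHomologyNeZero : ℕ → Prop
  | 0 => ¬ (⊤ : Submodule R (P.ι 0 →₀ R)) ≤ LinearMap.range (P.lin 0)
  | i + 1 => ¬ LinearMap.ker (P.lin i) ≤ LinearMap.range (P.lin (i + 1))

/-- `sup {i | H_i(lin(P)) ≠ 0}`, with value `⊥ = -∞` if there is no such `i`. -/
def linDefect : WithBot ℕ∞ :=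
  ⨆ (i : ℕ) (_ : P.LinHomologyNeZero i), ((i : ℕ∞) : WithBot ℕ∞)

end GradedFreeResolution

/-- The linearity defect of `M`, computed by its minimal graded free resolution `P`. For finitely
generated `M` (over `R` with `R_0` a field) such a `P` exists and is unique up to isomorphism, so
that all the terms of this infimum are equal. -/
def linearityDefect (M : GrMod 𝓡) : WithBot ℕ∞ :=
  ⨅ (P : GradedFreeResolution M) (_ : P.IsMinimal), P.linDefect

variable (𝓡)

/-- The left module `R/𝔪`, where `𝔪 = ⨁_{i > 0} R_i`. -/
abbrev ResidueModule : Type u := R ⧸ (HomogeneousIdeal.irrelevant 𝓡).toIdeal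

/-- The graded left module `R/𝔪`, concentrated in degree zero. -/
def residueGrMod : GrMod 𝓡 where
  carrier := ResidueModule 𝓡
  deg j := if j = 0 then ⊤ else ⊥
  isInternal := by
    have key : ∀ x : ⨁ j : ℤ, ((if j = 0 then ⊤ else ⊥ : AddSubgroup (ResidueModule 𝓡))),
        x = DirectSum.of _ 0 (x 0) := by
      intro x
      refine DFinsupp.ext fun j => ?_
      by_cases hj : j = 0
      · subst hj
        rw [DirectSum.of_eq_same]
      · rw [DirectSum.of_eq_of_ne _ _ _ hj]
        apply Subtype.ext
        have h := (x j).2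
        simpa [hj] using h
    constructor
    · rw [injective_iff_map_eq_zero]
      intro x hx
      rw [key x, DirectSum.coeAddMonoidHom_of] at hx
      rw [key x, Subtype.ext (a1 := x 0) (a2 := 0) hx, map_zero]
    · intro m
      exact ⟨DirectSum.of _ 0 ⟨m, by simp⟩, DirectSum.coeAddMonoidHom_of _ _ _⟩
  smul_mem := by
    intro i j r m hr hm
    by_cases hj : j = 0
    · rcases Nat.eq_zero_or_pos i with rfl | hi
      · simp [hj]
      · induction m using Submodule.Quotient.induction_on with
        | H a =>
          have h : r • (Submodule.Quotient.mk a : ResidueModule 𝓡) = 0 := by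
            rw [← Submodule.Quotient.mk_smul, Submodule.Quotient.mk_eq_zero]
            have hr' : r ∈ HomogeneousIdeal.irrelevant 𝓡 :=
              HomogeneousIdeal.mem_irrelevant_of_mem 𝓡 hi hr
            change r • a ∈ HomogeneousIdeal.irrelevant 𝓡
            rw [HomogeneousIdeal.mem_irrelevant_iff] at hr' ⊢
            change GradedRing.projZeroRingHom 𝓡 (r * a) = 0
            change GradedRing.projZeroRingHom 𝓡 r = 0 at hr'
            rw [map_mul, hr', zero_mul]
          rw [h]
          exact zero_mem _
    · rw [if_neg hj, AddSubgroup.mem_bot] at hm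
      rw [hm, smul_zero]
      exact zero_mem _

/-- `R` is Koszul: `R/𝔪` has a graded free resolution
`⋯ → R(-2)^{β₂} → R(-1)^{β₁} → R^{β₀} → R/𝔪 → 0` with natural numbers `β_i`. -/
def IsKoszul : Prop :=
  ∃ P : GradedFreeResolution (residueGrMod 𝓡),
    (∀ i, Finite (P.ι i)) ∧ ∀ (i : ℕ) (s : P.ι i), P.deg i s = i

end Resolutions

/-! ## The Yoneda algebra `⨁ n, Ext^n(X, X)` -/

section Yoneda

/-- `Ext^n_R(X, X)` for a left `R`-module `X`. -/
def SelfExt {R : Type u} [Ring R] (X : ModuleCat.{u} R) (n : ℕ) : Type u := Ext X X n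

variable {R : Type u} [Ring R] (X : ModuleCat.{u} R)

instance (n : ℕ) : AddCommGroup (SelfExt X n) := inferInstanceAs (AddCommGroup (Ext X X n))

/-- The Yoneda product `f ∘ g` of `f : X → X[a]` and `g : X → X[b]`. Note that `Ext.comp` is
written in diagrammatic order. -/
def SelfExt.mul {X : ModuleCat.{u} R} {a b : ℕ} (f : SelfExt X a) (g : SelfExt X b) :
    SelfExt X (a + b) :=
  Ext.comp (X := X) (Y := X) (Z := X) g f (add_comm b a)

/-- The identity of `X` in `Ext^0_R(X, X)`. -/
def SelfExt.one (X : ModuleCat.{u} R) : SelfExt X 0 := Ext.mk₀ (𝟙 X)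

instance : GradedMonoid.GMul (SelfExt X) where
  mul f g := SelfExt.mul f g

instance : GradedMonoid.GOne (SelfExt X) where
  one := SelfExt.one X

instance : DirectSum.GRing (SelfExt X) where
  mul_zero f := Ext.zero_comp (X := X) (Y := X) (Z := X) _ f _ (add_comm _ _)
  zero_mul g := Ext.comp_zero (X := X) (Y := X) g X _ _ (add_comm _ _)
  mul_add f g g' := Ext.add_comp (X := X) (Y := X) g g' f (add_comm _ _)
  add_mul f f' g := Ext.comp_add (X := X) (Y := X) g f f' (add_comm _ _)
  one_mul := by
    rintro ⟨n, f⟩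
    have h : ∀ (m : ℕ) (hm : n + 0 = m), GradedMonoid.mk (A := SelfExt X) m
        (Ext.comp (X := X) (Y := X) (Z := X) f (Ext.mk₀ (𝟙 X)) hm) = ⟨n, f⟩ := by
      rintro m rfl
      exact congrArg (Sigma.mk n) (Ext.comp_mk₀_id (X := X) (Y := X) f)
    exact h (0 + n) (add_comm n 0)
  mul_one := by
    rintro ⟨n, f⟩
    have h : ∀ (m : ℕ) (hm : 0 + n = m), GradedMonoid.mk (A := SelfExt X) m
        (Ext.comp (X := X) (Y := X) (Z := X) (Ext.mk₀ (𝟙 X)) f hm) = ⟨n, f⟩ := by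
      intro m hm
      obtain rfl : m = n := by omega
      exact congrArg (Sigma.mk m) (Ext.mk₀_id_comp (X := X) (Y := X) f)
    exact h (n + 0) (add_comm 0 n)
  mul_assoc := by
    rintro ⟨a, f⟩ ⟨b, g⟩ ⟨c, h⟩
    have key : ∀ (m m' : ℕ) (hm : c + (a + b) = m) (hm' : c + b + a = m'),
        GradedMonoid.mk (A := SelfExt X) m
          (Ext.comp (X := X) (Y := X) (Z := X) h
            (Ext.comp (X := X) (Y := X) (Z := X) g f (add_comm b a)) hm) =
        GradedMonoid.mk (A := SelfExt X) m'
          (Ext.comp (X := X) (Y := X) (Z := X)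
            (Ext.comp (X := X) (Y := X) (Z := X) h g rfl) f hm') := by
      intro m m' hm hm'
      obtain rfl : m = m' := by omega
      exact congrArg (Sigma.mk m) (Ext.comp_assoc (X := X) (Y := X) (Z := X) (T := X)
        h g f rfl (add_comm b a) (by omega)).symm
    have key' : ∀ (e : ℕ) (he : c + b = e) (hm' : e + a = a + (b + c)),
        GradedMonoid.mk (A := SelfExt X) (a + b + c)
          (Ext.comp (X := X) (Y := X) (Z := X) h
            (Ext.comp (X := X) (Y := X) (Z := X) g f (add_comm b a)) (add_comm c (a + b))) =
        GradedMonoid.mk (A := SelfExt X) (a + (b + c))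
          (Ext.comp (X := X) (Y := X) (Z := X)
            (Ext.comp (X := X) (Y := X) (Z := X) h g he) f hm') := by
      rintro e rfl hm'
      exact key _ _ _ _
    exact key' (b + c) (add_comm c b) (add_comm (b + c) a)
  natCast n := n • SelfExt.one X
  natCast_zero := zero_smul _ _
  natCast_succ n := succ_nsmul _ _
  intCast n := n • SelfExt.one X
  intCast_ofNat n := natCast_zsmul _ _
  intCast_negSucc_ofNat n := negSucc_zsmul _ _

/-- The Yoneda algebra `⨁ n, Ext^n_R(X, X)`. -/
abbrev YonedaAlgebra : Type u := ⨁ n, SelfExt X n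

/-- The component `Ext^n_R(X, X)` of the Yoneda algebra. -/
def yonedaDeg (n : ℕ) : AddSubgroup (YonedaAlgebra X) := (DirectSum.of (SelfExt X) n).range

instance : GradedRing (yonedaDeg X) where
  one_mem := ⟨SelfExt.one X, rfl⟩
  mul_mem := by
    rintro i j _ _ ⟨f, rfl⟩ ⟨g, rfl⟩
    exact ⟨SelfExt.mul f g, (DirectSum.of_mul_of f g).symm⟩
  toDecomposition := DirectSum.Decomposition.ofAddHom _
    (DirectSum.toAddMonoid fun n =>
      (DirectSum.of (fun n => yonedaDeg X n) n).comp (DirectSum.of (SelfExt X) n).rangeRestrict)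
    (by
      ext n f : 2
      simp only [AddMonoidHom.comp_apply, DirectSum.toAddMonoid_of, AddMonoidHom.id_apply]
      exact DirectSum.coeAddMonoidHom_of _ _ _)
    (by
      ext n ⟨_, f, rfl⟩ : 2
      simp only [AddMonoidHom.comp_apply, DirectSum.toAddMonoid_of, DirectSum.coeAddMonoidHom_of,
        AddMonoidHom.id_apply]
      rfl)

end Yoneda

section KoszulDual

variable {A : Type u} {σ : Type v} [Ring A] [SetLike σ A] [AddSubgroupClass σ A]
  (𝒜 : ℕ → σ) [GradedRing 𝒜]

/-- The Koszul dual `A^! = ⨁ n, Ext^n_A(K, K)` with the Yoneda product, where `K = A/𝔪`. -/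
abbrev KoszulDual : Type u := YonedaAlgebra (ModuleCat.of A (ResidueModule 𝒜))

/-- The component of degree `n` of `A^!`. -/
abbrev koszulDualDeg (n : ℕ) : AddSubgroup (KoszulDual 𝒜) :=
  yonedaDeg (ModuleCat.of A (ResidueModule 𝒜)) n

end KoszulDual

end

end KoszulLD

/-! Write `K = A/𝔪` and let `Z_a` be the `a`-th syzygy of a minimal resolution `P`. Everything rests
on a link between linear parts and Yoneda products. If `H_{a+1}(lin P) = 0`, the linear columns of
the differential `P_{a+1} → P_a` are independent over `K`. Every map `Z_{a+1} → K` is then a sum of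
maps `Z_{a+1} → 𝔪 → K` whose first factor extends to `P_a → A` (`exists_factorization`). Through
extension classes and dimension shifting, `H_{j+1}(lin P) = 0` yields `Ext^{j+1}(M, K) = Ext^1(K, K)
· Ext^j(M, K)` (`IsMinimal.extGenerated_syz`). For `K` itself, whose resolution is linear, this says
that `A^!` is generated in degree one; for `M` of finite linearity defect it holds for all large
`j`.

Coherence of `A^!` is a statement about relations `∑ b_k u_k = 0`. One may take all `u_k` in one
degree `n + 1`, and then `u_k` is represented by a map `φ_k : W → K` on the syzygy `W = Z_{n+1}` of
`K`. The fibre product `N` of `W` and `A^κ` over `K^κ` sits in `0 → 𝔪^κ → N → W → 0`. Its long exact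
sequence identifies relations of high degree with elements of `Ext(𝔪^κ, K)` that lift to `Ext(N, K)`
(`exists_reduced_relations`). Since `W` is generated in a single degree, `N` is a finitely generated
graded module (`exists_fibreProduct`), so `Ext(N, K)` is eventually generated by `Ext^1(K, K)`, and
therefore so are the relations. With finite-dimensional components this makes the relation modules
finitely generated (`isLeftGradedCoherent_of_relations`).

The categorical part is the usual consequence of coherence: kernels and cokernels of maps between
finitely presented graded modules are finitely presented, so the subcategory inherits them from the
abelian category of graded modules (`abelian_isFP`). -/

namespace KoszulLD

set_option linter.unusedSectionVars false

noncomputable section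

/-! ## Homogeneous components and constructions of graded modules -/

section GrModBasics

/-- A family of additive subgroups that spans and is independent is internally direct. -/
lemma isInternal_of_sum_eq_zero {M : Type*} [AddCommGroup M] (deg : ℤ → AddSubgroup M)
    (indep : ∀ (s : Finset ℤ) (y : ℤ → M), (∀ j, y j ∈ deg j) → ∑ j ∈ s, y j = 0 →
      ∀ j ∈ s, y j = 0)
    (span : ∀ x, x ∈ ⨆ j, deg j) : DirectSum.IsInternal deg := by
  classical
  constructor
  · rw [injective_iff_map_eq_zero]
    intro x hx
    rw [DirectSum.coeAddMonoidHom_eq_dfinsuppSum, DFinsupp.sum] at hx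
    have h := indep _ (fun j => ((x j : deg j) : M)) (fun j => (x j).2) hx
    refine DFinsupp.ext fun j => ?_
    by_cases hj : j ∈ DFinsupp.support x
    · exact Subtype.ext (h j hj)
    · simpa using hj
  · intro m
    have : (⨆ j, deg j) ≤ (DirectSum.coeAddMonoidHom deg).range :=
      iSup_le fun j m hm => ⟨DirectSum.of _ j ⟨m, hm⟩, DirectSum.coeAddMonoidHom_of _ _ _⟩
    exact this (span m)

variable {R : Type u} {σ : Type v} [Ring R] [SetLike σ R] [AddSubgroupClass σ R] {𝓡 : ℕ → σ}

namespace GrMod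

variable (M : GrMod 𝓡)

/-- The projection to the homogeneous component of degree `j`. -/
def proj (j : ℤ) : M.carrier →+ M.carrier :=
  ((M.deg j).subtype.comp
    (DFinsupp.evalAddMonoidHom (β := fun j => M.deg j) j)).comp
    (AddEquiv.ofBijective (DirectSum.coeAddMonoidHom M.deg) M.isInternal).symm.toAddMonoidHom

lemma proj_mem (j : ℤ) (x : M.carrier) : M.proj j x ∈ M.deg j :=
  Subtype.prop _

lemma proj_of_mem {j : ℤ} {x : M.carrier} (hx : x ∈ M.deg j) : M.proj j x = x := by
  have : (AddEquiv.ofBijective (DirectSum.coeAddMonoidHom M.deg) M.isInternal).symm x =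
      DirectSum.of (fun j => M.deg j) j ⟨x, hx⟩ := by
    rw [AddEquiv.symm_apply_eq]
    exact (DirectSum.coeAddMonoidHom_of M.deg j ⟨x, hx⟩).symm
  change (((AddEquiv.ofBijective (DirectSum.coeAddMonoidHom M.deg) M.isInternal).symm x) j :
    M.carrier) = x
  rw [this, DirectSum.of_eq_same]

lemma proj_of_mem_ne {i j : ℤ} (h : i ≠ j) {x : M.carrier} (hx : x ∈ M.deg i) :
    M.proj j x = 0 := by
  have : (AddEquiv.ofBijective (DirectSum.coeAddMonoidHom M.deg) M.isInternal).symm x =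
      DirectSum.of (fun j => M.deg j) i ⟨x, hx⟩ := by
    rw [AddEquiv.symm_apply_eq]
    exact (DirectSum.coeAddMonoidHom_of M.deg i ⟨x, hx⟩).symm
  change (((AddEquiv.ofBijective (DirectSum.coeAddMonoidHom M.deg) M.isInternal).symm x) j :
    M.carrier) = 0
  rw [this, DirectSum.of_eq_of_ne _ _ _ (Ne.symm h), ZeroMemClass.coe_zero]

lemma exists_eq_sum_proj (x : M.carrier) : ∃ s : Finset ℤ, x = ∑ j ∈ s, M.proj j x := by
  classical
  set e := AddEquiv.ofBijective (DirectSum.coeAddMonoidHom M.deg) M.isInternal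
  refine ⟨DFinsupp.support (e.symm x), ?_⟩
  conv_lhs => rw [← e.apply_symm_apply x]
  change DirectSum.coeAddMonoidHom M.deg (e.symm x) = _
  rw [DirectSum.coeAddMonoidHom_eq_dfinsuppSum, DFinsupp.sum]
  rfl

lemma proj_sum_of_mem {s : Finset ℤ} {y : ℤ → M.carrier} (hy : ∀ j, y j ∈ M.deg j) {j : ℤ}
    (hj : j ∈ s) : M.proj j (∑ j ∈ s, y j) = y j := by
  rw [map_sum, Finset.sum_eq_single_of_mem j hj
    (fun i _ h => M.proj_of_mem_ne h (hy i)), M.proj_of_mem (hy j)]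

lemma map_proj {M N : GrMod 𝓡} (f : M ⟶ N) (j : ℤ) (x : M.carrier) :
    f.1 (M.proj j x) = N.proj j (f.1 x) := by
  obtain ⟨s, hs⟩ := M.exists_eq_sum_proj x
  have key : ∀ i, f.1 (M.proj j (M.proj i x)) = N.proj j (f.1 (M.proj i x)) := by
    intro i
    by_cases h : i = j
    · subst h
      rw [M.proj_of_mem (M.proj_mem i x), N.proj_of_mem (f.2 i _ (M.proj_mem i x))]
    · rw [M.proj_of_mem_ne h (M.proj_mem i x), N.proj_of_mem_ne h (f.2 i _ (M.proj_mem i x)),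
        map_zero]
  rw [hs]
  simp only [map_sum, key]

lemma proj_smul {i : ℕ} {r : R} (hr : r ∈ 𝓡 i) (j : ℤ) (x : M.carrier) :
    M.proj j (r • x) = r • M.proj (j - i) x := by
  obtain ⟨s, hs⟩ := M.exists_eq_sum_proj x
  have key : ∀ k, M.proj j (r • M.proj k x) = r • M.proj (j - i) (M.proj k x) := by
    intro k
    by_cases h : (i : ℤ) + k = j
    · have h' : j - i = k := by omega
      rw [h', M.proj_of_mem (M.proj_mem k x),
        M.proj_of_mem (h ▸ M.smul_mem hr (M.proj_mem k x))]
    · have h' : k ≠ j - i := by omega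
      rw [M.proj_of_mem_ne h (M.smul_mem hr (M.proj_mem k x)),
        M.proj_of_mem_ne h' (M.proj_mem k x), smul_zero]
  rw [hs]
  simp only [map_sum, Finset.smul_sum, key]

/-- A submodule is homogeneous if it contains the homogeneous components of its elements. -/
def IsHomog (L : Submodule R M.carrier) : Prop := ∀ x ∈ L, ∀ j, M.proj j x ∈ L

variable {M}

lemma isHomog_ker {N : GrMod 𝓡} (f : M ⟶ N) : M.IsHomog (LinearMap.ker f.1) := by
  intro x hx j
  rw [LinearMap.mem_ker] at hx ⊢
  rw [map_proj, hx, map_zero]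

lemma IsHomog.map {N : GrMod 𝓡} (f : M ⟶ N) {L : Submodule R M.carrier} (hL : M.IsHomog L) :
    N.IsHomog (L.map f.1) := by
  rintro _ ⟨x, hx, rfl⟩ j
  exact ⟨_, hL x hx j, map_proj f j x⟩

lemma IsHomog.comap {N : GrMod 𝓡} (f : M ⟶ N) {L : Submodule R N.carrier} (hL : N.IsHomog L) :
    M.IsHomog (L.comap f.1) := by
  intro x hx j
  rw [Submodule.mem_comap, map_proj]
  exact hL _ hx j

lemma isHomog_range {N : GrMod 𝓡} (f : M ⟶ N) : N.IsHomog (LinearMap.range f.1) := by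
  rintro _ ⟨x, rfl⟩ j
  exact ⟨_, map_proj f j x⟩

lemma IsHomog.inf {L L' : Submodule R M.carrier} (h : M.IsHomog L) (h' : M.IsHomog L') :
    M.IsHomog (L ⊓ L') :=
  fun x hx j => ⟨h x hx.1 j, h' x hx.2 j⟩

lemma isHomog_span [GradedRing 𝓡] {S : Set M.carrier} (hS : ∀ x ∈ S, ∃ j, x ∈ M.deg j) :
    M.IsHomog (Submodule.span R S) := by
  intro x hx
  induction hx using Submodule.span_induction with
  | mem x hx =>
    intro j
    obtain ⟨i, hi⟩ := hS x hx
    by_cases h : i = j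
    · subst h
      rw [M.proj_of_mem hi]
      exact Submodule.subset_span hx
    · rw [M.proj_of_mem_ne h hi]
      exact zero_mem _
  | zero => simp
  | add x y _ _ hx hy => exact fun j => by rw [map_add]; exact add_mem (hx j) (hy j)
  | smul r x _ hx =>
    intro j
    induction r using DirectSum.Decomposition.inductionOn 𝓡 with
    | zero => simp
    | @homogeneous i r =>
      rw [M.proj_smul r.2]
      exact Submodule.smul_mem _ _ (hx _)
    | add r r' h h' => rw [add_smul, map_add]; exact add_mem h h'

variable (M) in
/-- A homogeneous submodule as a graded module. -/
def ofSub (L : Submodule R M.carrier) (hL : M.IsHomog L) : GrMod 𝓡 where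
  carrier := L
  deg j := (M.deg j).comap L.subtype.toAddMonoidHom
  isInternal := by
    refine isInternal_of_sum_eq_zero _ (fun s y hy h j hj => ?_) fun x => ?_
    · have h' : ∑ j ∈ s, (y j : M.carrier) = 0 := by
        have := congrArg Subtype.val h
        simpa using this
      apply Subtype.ext
      have := M.proj_sum_of_mem (y := fun j => (y j : M.carrier)) (fun j => hy j) hj
      rw [ZeroMemClass.coe_zero, ← this, h', map_zero]
    · obtain ⟨s, hs⟩ := M.exists_eq_sum_proj x
      have : x = ∑ j ∈ s, (⟨M.proj j x, hL x x.2 j⟩ : L) := by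
        apply Subtype.ext
        simpa using hs
      rw [this]
      exact sum_mem fun j _ => AddSubgroup.mem_iSup_of_mem j (M.proj_mem j x)
  smul_mem hr hm := M.smul_mem hr hm

variable (M) in
/-- The quotient by a homogeneous submodule as a graded module. -/
def quot (L : Submodule R M.carrier) (hL : M.IsHomog L) : GrMod 𝓡 where
  carrier := M.carrier ⧸ L
  deg j := (M.deg j).map L.mkQ.toAddMonoidHom
  isInternal := by
    refine isInternal_of_sum_eq_zero _ (fun s y hy h j hj => ?_) fun x => ?_
    · choose z hz hzy using hy
      have h' : ∑ j ∈ s, z j ∈ L := by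
        rw [← L.ker_mkQ, LinearMap.mem_ker, map_sum, ← h]
        exact Finset.sum_congr rfl fun j _ => hzy j
      rw [← hzy j]
      change L.mkQ (z j) = 0
      rw [← LinearMap.mem_ker, L.ker_mkQ, ← M.proj_sum_of_mem hz hj]
      exact hL _ h' j
    · obtain ⟨x, rfl⟩ := L.mkQ_surjective x
      obtain ⟨s, hs⟩ := M.exists_eq_sum_proj x
      rw [hs, map_sum]
      exact sum_mem fun j _ => AddSubgroup.mem_iSup_of_mem j ⟨_, M.proj_mem j x, rfl⟩
  smul_mem := by
    rintro i j r _ hr ⟨m, hm, rfl⟩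
    exact ⟨r • m, M.smul_mem hr hm, rfl⟩

variable (M) in
/-- The product of two graded modules. -/
def prod (N : GrMod 𝓡) : GrMod 𝓡 where
  carrier := M.carrier × N.carrier
  deg j := (M.deg j).prod (N.deg j)
  isInternal := by
    refine isInternal_of_sum_eq_zero _ (fun s y hy h j hj => ?_) fun x => ?_
    · have h1 : ∑ j ∈ s, (y j).1 = 0 := by rw [← Prod.fst_sum, h]; rfl
      have h2 : ∑ j ∈ s, (y j).2 = 0 := by rw [← Prod.snd_sum, h]; rfl
      apply Prod.ext
      · rw [← M.proj_sum_of_mem (fun j => (hy j).1) hj, h1, map_zero]; rfl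
      · rw [← N.proj_sum_of_mem (fun j => (hy j).2) hj, h2, map_zero]; rfl
    · obtain ⟨s, hs⟩ := M.exists_eq_sum_proj x.1
      obtain ⟨t, ht⟩ := N.exists_eq_sum_proj x.2
      have : x = ∑ j ∈ s, ((M.proj j x.1, 0) : M.carrier × N.carrier) +
          ∑ j ∈ t, ((0, N.proj j x.2) : M.carrier × N.carrier) := by
        apply Prod.ext
        · simpa [Prod.fst_sum] using hs
        · simpa [Prod.snd_sum] using ht
      rw [this]
      exact add_mem
        (sum_mem fun j _ => AddSubgroup.mem_iSup_of_mem j ⟨M.proj_mem j _, zero_mem _⟩)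
        (sum_mem fun j _ => AddSubgroup.mem_iSup_of_mem j ⟨zero_mem _, N.proj_mem j _⟩)
  smul_mem hr hm := ⟨M.smul_mem hr hm.1, N.smul_mem hr hm.2⟩

variable (𝓡) in
/-- The zero graded module. -/
def zero : GrMod 𝓡 where
  carrier := PUnit
  deg _ := ⊥
  isInternal := isInternal_of_sum_eq_zero _ (fun _ _ _ _ _ _ => rfl) fun _ => zero_mem _
  smul_mem _ _ := rfl

end GrMod

variable [GradedRing 𝓡]

variable (𝓡) in
/-- The elements of degree `n`, for an integer `n`, as an additive subgroup. -/
def homogDeg (n : ℤ) : AddSubgroup R where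
  carrier := {r | IsHomogeneousOfDegree 𝓡 n r}
  zero_mem' := Or.inl rfl
  add_mem' := by
    rintro a b (rfl | ⟨k, hk, ha⟩) hb
    · simpa using hb
    · rcases hb with rfl | ⟨l, hl, hb⟩
      · rw [add_zero]; exact Or.inr ⟨k, hk, ha⟩
      · obtain rfl : k = l := by omega
        exact Or.inr ⟨k, hk, add_mem ha hb⟩
  neg_mem' := by
    rintro a (rfl | ⟨k, hk, ha⟩)
    · exact Or.inl neg_zero
    · exact Or.inr ⟨k, hk, neg_mem ha⟩

lemma mem_homogDeg {n : ℤ} {r : R} : r ∈ homogDeg 𝓡 n ↔ IsHomogeneousOfDegree 𝓡 n r := Iff.rfl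

lemma mem_homogDeg_natCast {n : ℕ} {r : R} : r ∈ homogDeg 𝓡 n ↔ r ∈ 𝓡 n := by
  constructor
  · rintro (rfl | ⟨k, hk, h⟩)
    · exact zero_mem _
    · obtain rfl : k = n := by omega
      exact h
  · exact fun h => Or.inr ⟨n, rfl, h⟩

lemma smul_mem_homogDeg {i : ℕ} {n : ℤ} {r s : R} (hr : r ∈ 𝓡 i) (hs : s ∈ homogDeg 𝓡 n) :
    r * s ∈ homogDeg 𝓡 (i + n) := by
  rcases hs with rfl | ⟨k, rfl, hs⟩
  · rw [mul_zero]; exact zero_mem _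
  · exact Or.inr ⟨i + k, by push_cast; ring, SetLike.mul_mem_graded hr hs⟩

lemma eq_zero_of_sum_homogDeg {s : Finset ℤ} {y : ℤ → R} {d : ℤ}
    (hy : ∀ j, y j ∈ homogDeg 𝓡 (j - d)) (h : ∑ j ∈ s, y j = 0) {j : ℤ} (hj : j ∈ s) :
    y j = 0 := by
  rcases hy j with h0 | ⟨k, hk, hjk⟩
  · exact h0
  · have := congrArg (GradedRing.proj 𝓡 k) h
    rw [map_sum, map_zero, Finset.sum_eq_single_of_mem j hj] at this
    · rwa [GradedRing.proj_apply, DirectSum.decompose_of_mem_same _ hjk] at this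
    · intro i _ hij
      rcases hy i with h0 | ⟨l, hl, hil⟩
      · rw [h0, map_zero]
      · rw [GradedRing.proj_apply, DirectSum.decompose_of_mem_ne _ hil]
        omega

variable (𝓡) in
/-- The graded free module on generators of prescribed degrees. -/
def GrMod.free (ι : Type u) (d : ι → ℤ) : GrMod 𝓡 where
  carrier := ι →₀ R
  deg j := ⨅ s, (homogDeg 𝓡 (j - d s)).comap (Finsupp.applyAddHom s)
  isInternal := by
    classical
    refine isInternal_of_sum_eq_zero _ (fun s y hy h j hj => ?_) fun x => ?_
    · ext t
      refine eq_zero_of_sum_homogDeg (𝓡 := 𝓡) (y := fun j => y j t) (d := d t) (s := s)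
        (fun j => ?_) ?_ hj
      · exact (AddSubgroup.mem_iInf.1 (hy j)) t
      · rw [← Finsupp.finsetSum_apply, h, Finsupp.zero_apply]
    · induction x using Finsupp.induction_linear with
      | zero => exact zero_mem _
      | add x y hx hy => exact add_mem hx hy
      | single t r =>
        induction r using DirectSum.Decomposition.inductionOn 𝓡 with
        | zero => rw [Finsupp.single_zero]; exact zero_mem _
        | @homogeneous i r =>
          refine AddSubgroup.mem_iSup_of_mem ((i : ℤ) + d t) (AddSubgroup.mem_iInf.2 fun s => ?_)
          change Finsupp.single t (r : R) s ∈ homogDeg 𝓡 _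
          by_cases h : t = s
          · subst h
            rw [Finsupp.single_eq_same]
            exact Or.inr ⟨i, by ring, r.2⟩
          · rw [Finsupp.single_eq_of_ne (Ne.symm h)]
            exact zero_mem _
        | add r r' h h' => rw [Finsupp.single_add]; exact add_mem h h'
  smul_mem := by
    intro i j r m hr hm
    refine AddSubgroup.mem_iInf.2 fun s => ?_
    have := smul_mem_homogDeg hr (AddSubgroup.mem_iInf.1 hm s)
    rwa [← add_sub_assoc] at this

lemma GrMod.mem_free_deg {ι : Type u} {d : ι → ℤ} {j : ℤ} {x : ι →₀ R} :
    x ∈ (GrMod.free 𝓡 ι d).deg j ↔ ∀ s, x s ∈ homogDeg 𝓡 (j - d s) :=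
  AddSubgroup.mem_iInf

/-- The degree zero map from a graded free module determined by homogeneous elements. -/
def GrMod.freeDesc {ι : Type u} {d : ι → ℤ} {M : GrMod 𝓡} (m : ι → M.carrier)
    (hm : ∀ s, m s ∈ M.deg (d s)) : GrMod.free 𝓡 ι d ⟶ M :=
  ⟨Finsupp.linearCombination R m, by
    have key : ∀ (j : ℤ) (x : ι →₀ R), (∀ s, x s ∈ homogDeg 𝓡 (j - d s)) →
        Finsupp.linearCombination R m x ∈ M.deg j := by
      intro j x hx
      rw [Finsupp.linearCombination_apply]
      refine sum_mem fun s _ => ?_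
      change x s • m s ∈ _
      rcases hx s with h | ⟨k, hk, h⟩
      · rw [h, zero_smul]; exact zero_mem _
      · have := M.smul_mem h (hm s)
        rwa [hk, sub_add_cancel] at this
    exact fun j x hx => key j x (mem_free_deg.1 hx)⟩

end GrModBasics


/-! ## The abelian category of graded modules -/

section GrModAbelian

variable {R : Type u} {σ : Type v} [Ring R] [SetLike σ R] [AddSubgroupClass σ R] {𝓡 : ℕ → σ}

namespace GrMod

lemma hom_ext {M N : GrMod 𝓡} {f g : M ⟶ N} (h : ∀ x, f.1 x = g.1 x) : f = g :=
  Subtype.ext (LinearMap.ext h)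

lemma comp_val {M N L : GrMod 𝓡} (f : M ⟶ N) (g : N ⟶ L) (x : M.carrier) :
    (f ≫ g).1 x = g.1 (f.1 x) := rfl

lemma zero_val {M N : GrMod 𝓡} (x : M.carrier) : (0 : M ⟶ N).1 x = 0 := rfl

/-- The inclusion of a homogeneous submodule. -/
def subι (M : GrMod 𝓡) (L : Submodule R M.carrier) (hL : M.IsHomog L) : M.ofSub L hL ⟶ M :=
  ⟨L.subtype, fun _ _ hm => hm⟩

/-- The projection to the quotient by a homogeneous submodule. -/
def quotπ (M : GrMod 𝓡) (L : Submodule R M.carrier) (hL : M.IsHomog L) : M ⟶ M.quot L hL :=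
  ⟨L.mkQ, fun _ m hm => ⟨m, hm, rfl⟩⟩

/-- Corestriction of a morphism to a homogeneous submodule. -/
def subLift {M N : GrMod 𝓡} (f : N ⟶ M) (L : Submodule R M.carrier) (hL : M.IsHomog L)
    (h : ∀ x, f.1 x ∈ L) : N ⟶ M.ofSub L hL :=
  ⟨f.1.codRestrict L h, fun j m hm => f.2 j m hm⟩

/-- The morphism from a quotient induced by a morphism killing the homogeneous submodule. -/
def quotDesc {M N : GrMod 𝓡} (f : M ⟶ N) (L : Submodule R M.carrier) (hL : M.IsHomog L)
    (h : L ≤ LinearMap.ker f.1) : M.quot L hL ⟶ N :=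
  ⟨L.liftQ f.1 h, by
    rintro j _ ⟨m, hm, rfl⟩
    exact f.2 j m hm⟩

/-- The inclusion of the submodule `ker f` is a kernel of `f`. -/
def kernelIsLimit {M N : GrMod 𝓡} (f : M ⟶ N) :
    IsLimit (KernelFork.ofι (f := f) (subι M _ (isHomog_ker f))
      (hom_ext fun x => LinearMap.mem_ker.1 x.2)) :=
  KernelFork.IsLimit.ofι _ _
    (fun g hg => subLift g _ _ fun x => by
      rw [LinearMap.mem_ker, ← comp_val, hg, zero_val])
    (fun _ _ => rfl)
    (fun _ _ m hm => hom_ext fun x => Subtype.ext (congrArg (fun g => g.1 x) hm))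

/-- The projection modulo `range f` is a cokernel of `f`. -/
def cokernelIsColimit {M N : GrMod 𝓡} (f : M ⟶ N) :
    IsColimit (CokernelCofork.ofπ (f := f) (quotπ N _ (isHomog_range f))
      (hom_ext fun x => (Submodule.Quotient.mk_eq_zero _).2 ⟨x, rfl⟩)) :=
  CokernelCofork.IsColimit.ofπ _ _
    (fun g hg => quotDesc g _ _ (by
      rintro _ ⟨x, rfl⟩
      rw [LinearMap.mem_ker, ← comp_val, hg, zero_val]))
    (fun _ _ => rfl)
    (fun _ _ m hm => hom_ext fun x => by
      obtain ⟨x, rfl⟩ := Submodule.mkQ_surjective _ x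
      exact congrArg (fun g => g.1 x) hm)

instance : HasKernels (GrMod 𝓡) := ⟨fun f => ⟨⟨_, kernelIsLimit f⟩⟩⟩

instance : HasCokernels (GrMod 𝓡) := ⟨fun f => ⟨⟨_, cokernelIsColimit f⟩⟩⟩

lemma isZero_of_subsingleton (M : GrMod 𝓡) [Subsingleton M.carrier] : IsZero M := by
  rw [IsZero.iff_id_eq_zero]
  exact hom_ext fun x => Subsingleton.elim _ _

instance : HasZeroObject (GrMod 𝓡) :=
  ⟨⟨zero 𝓡, have : Subsingleton (zero 𝓡).carrier := inferInstanceAs (Subsingleton PUnit)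
    isZero_of_subsingleton _⟩⟩

/-- The product of graded modules as a bicone. -/
def prodBicone (M N : GrMod 𝓡) : BinaryBicone M N where
  pt := M.prod N
  fst := ⟨LinearMap.fst R _ _, fun _ _ hm => hm.1⟩
  snd := ⟨LinearMap.snd R _ _, fun _ _ hm => hm.2⟩
  inl := ⟨LinearMap.inl R _ _, fun _ _ hm => ⟨hm, zero_mem _⟩⟩
  inr := ⟨LinearMap.inr R _ _, fun _ _ hm => ⟨zero_mem _, hm⟩⟩
  inl_fst := rfl
  inl_snd := rfl
  inr_fst := rfl
  inr_snd := rfl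

/-- The product of graded modules is a biproduct. -/
def prodIsBilimit (M N : GrMod 𝓡) : (prodBicone M N).IsBilimit :=
  isBinaryBilimitOfTotal _ (hom_ext fun x => by
    refine Prod.ext ?_ ?_
    · change x.1 + 0 = x.1
      exact add_zero _
    · change 0 + x.2 = x.2
      exact zero_add _)

instance : HasBinaryBiproducts (GrMod 𝓡) := ⟨fun M N => ⟨⟨⟨_, prodIsBilimit M N⟩⟩⟩⟩

instance : HasFiniteProducts (GrMod 𝓡) :=
  have : HasTerminal (GrMod 𝓡) := HasZeroObject.hasTerminal
  hasFiniteProducts_of_has_binary_and_terminal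

/-- Being homogeneous, the kernel is itself a graded module, so its inclusion can be used as a test
morphism. -/
lemma injective_of_mono {M N : GrMod 𝓡} (f : M ⟶ N) [Mono f] : Function.Injective f.1 := by
  rw [injective_iff_map_eq_zero]
  intro x hx
  have h : subι M _ (isHomog_ker f) = 0 := by
    rw [← cancel_mono f, zero_comp]
    exact hom_ext fun x => LinearMap.mem_ker.1 x.2
  exact congrArg (fun g => g.1 ⟨x, hx⟩) h

lemma surjective_of_epi {M N : GrMod 𝓡} (f : M ⟶ N) [Epi f] : Function.Surjective f.1 := by
  have h : quotπ N _ (isHomog_range f) = 0 := by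
    rw [← cancel_epi f, comp_zero]
    exact hom_ext fun x => (Submodule.Quotient.mk_eq_zero _).2 ⟨x, rfl⟩
  intro y
  exact (Submodule.Quotient.mk_eq_zero _).1 (congrArg (fun g => g.1 y) h)

/-- The degreewise inverse of a bijective morphism. -/
def isoOfBijective {M N : GrMod 𝓡} (f : M ⟶ N) (hf : Function.Bijective f.1) : M ≅ N where
  hom := f
  inv := ⟨(LinearEquiv.ofBijective f.1 hf).symm.toLinearMap, by
    intro j y hy
    obtain ⟨x, rfl⟩ := hf.2 y
    change (LinearEquiv.ofBijective f.1 hf).symm (f.1 x) ∈ _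
    have h : (LinearEquiv.ofBijective f.1 hf).symm (f.1 x) = x :=
      (LinearEquiv.ofBijective f.1 hf).symm_apply_apply x
    rw [h]
    -- `x` and its degree `j` component have the same image, so injectivity makes `x` homogeneous.
    have h' : x = M.proj j x := hf.1 (by rw [map_proj, N.proj_of_mem hy])
    rw [h']
    exact M.proj_mem j x⟩
  hom_inv_id := hom_ext fun x => (LinearEquiv.ofBijective f.1 hf).symm_apply_apply x
  inv_hom_id := hom_ext fun x => (LinearEquiv.ofBijective f.1 hf).apply_symm_apply x

/-- Every monomorphism of graded modules is the kernel of its cokernel. -/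
@[reducible]
def normalMono {M N : GrMod 𝓡} (f : M ⟶ N) [Mono f] : NormalMono f where
  Z := N.quot _ (isHomog_range f)
  g := quotπ N _ (isHomog_range f)
  w := hom_ext fun x => (Submodule.Quotient.mk_eq_zero _).2 ⟨x, rfl⟩
  isLimit := by
    let g := quotπ N _ (isHomog_range f)
    have w : f ≫ g = 0 := hom_ext fun x => (Submodule.Quotient.mk_eq_zero _).2 ⟨x, rfl⟩
    let φ : M ⟶ N.ofSub _ (isHomog_ker g) :=
      subLift f _ _ fun x => by rw [LinearMap.mem_ker, ← comp_val, w, zero_val]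
    have hφ : Function.Bijective φ.1 := by
      refine ⟨fun x y h => injective_of_mono f (congrArg Subtype.val h), fun y => ?_⟩
      obtain ⟨x, hx⟩ := (Submodule.Quotient.mk_eq_zero _).1 (LinearMap.mem_ker.1 y.2)
      exact ⟨x, Subtype.ext hx⟩
    exact IsKernel.isoKernel g f (kernelIsLimit g) (isoOfBijective φ hφ) rfl

/-- Every epimorphism of graded modules is the cokernel of its kernel. -/
@[reducible]
def normalEpi {M N : GrMod 𝓡} (f : M ⟶ N) [Epi f] : NormalEpi f where
  W := M.ofSub _ (isHomog_ker f)
  g := subι M _ (isHomog_ker f)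
  w := hom_ext fun x => LinearMap.mem_ker.1 x.2
  isColimit := by
    let g := subι M _ (isHomog_ker f)
    have hg : LinearMap.range g.1 = LinearMap.ker f.1 := Submodule.range_subtype _
    let φ : M.quot _ (isHomog_range g) ⟶ N := quotDesc f _ _ hg.le
    have hφ : Function.Bijective φ.1 := by
      constructor
      · rw [injective_iff_map_eq_zero]
        intro x hx
        obtain ⟨x, rfl⟩ := Submodule.mkQ_surjective _ x
        exact (Submodule.Quotient.mk_eq_zero _).2 (hg.ge (LinearMap.mem_ker.2 hx))
      · intro y
        obtain ⟨x, rfl⟩ := surjective_of_epi f y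
        exact ⟨Submodule.mkQ _ x, rfl⟩
    exact IsCokernel.cokernelIso g f (cokernelIsColimit g) (isoOfBijective φ hφ) rfl

instance : Abelian (GrMod 𝓡) where
  normalMonoOfMono f _ := ⟨normalMono f⟩
  normalEpiOfEpi f _ := ⟨normalEpi f⟩

end GrMod

end GrModAbelian

/-! ## Finitely presented graded modules over a coherent ring -/

section FinitelyPresented

variable {R : Type u} {σ : Type v} [Ring R] [SetLike σ R] [AddSubgroupClass σ R] {𝓡 : ℕ → σ}

namespace GrMod

/-- A graded module is pseudo-coherent on a homogeneous submodule if all finitely generated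
homogeneous submodules contained in it are finitely presented. -/
def IsCoherentOn (M : GrMod 𝓡) (T : Submodule R M.carrier) : Prop :=
  ∀ L : Submodule R M.carrier, M.IsHomog L → L ≤ T → L.FG → Module.FinitePresentation R L

/-- `L` is an extension of `f(L)` by `L ∩ ker f`. Finite presentation of `f(L)` makes `L ∩ ker f`
finitely generated, hence finitely presented, and an extension of finitely presented modules is
finitely presented. The relative form, with `T`, is what permits induction on the rank of a free
module. -/
lemma isCoherentOn_of_ker {M N : GrMod 𝓡} (f : M ⟶ N) (hN : N.IsCoherentOn ⊤)
    (T : Submodule R M.carrier) (hT : M.IsCoherentOn (T ⊓ LinearMap.ker f.1)) :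
    M.IsCoherentOn T := by
  intro L hL hLT hfg
  have hmap : Module.FinitePresentation R (L.map f.1) :=
    hN _ (hL.map f) le_top (hfg.map f.1)
  let g : L →ₗ[R] L.map f.1 := f.1.submoduleMap L
  have hg : Function.Surjective g := LinearMap.submoduleMap_surjective f.1 L
  have : Module.Finite R L := Module.Finite.of_fg hfg
  have hker : (LinearMap.ker g).FG := Module.FinitePresentation.fg_ker g hg
  have hmapker : (LinearMap.ker g).map L.subtype = L ⊓ LinearMap.ker f.1 := by
    ext x
    constructor
    · rintro ⟨y, hy, rfl⟩
      exact ⟨y.2, congrArg Subtype.val (LinearMap.mem_ker.1 hy)⟩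
    · rintro ⟨hx, hx'⟩
      exact ⟨⟨x, hx⟩, LinearMap.mem_ker.2 (Subtype.ext hx'), rfl⟩
  have h2 : Module.FinitePresentation R (L ⊓ LinearMap.ker f.1 : Submodule R M.carrier) :=
    hT _ (hL.inf (isHomog_ker f)) (inf_le_inf_right _ hLT) (hmapker ▸ hker.map _)
  have : Module.FinitePresentation R (LinearMap.ker g) :=
    .of_equiv ((LinearEquiv.ofEq _ _ hmapker.symm).trans
      ((LinearMap.ker g).equivMapOfInjective _ L.injective_subtype).symm)
  exact Module.finitePresentation_of_ker g hg

/-- The preimage of `L` is finitely generated because `L` and `ker f` are; hence it is finitely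
presented, and `L` is its quotient by a finitely generated submodule. -/
lemma isCoherentOn_of_surjective {M N : GrMod 𝓡} (f : M ⟶ N) (hf : Function.Surjective f.1)
    (hM : M.IsCoherentOn ⊤) (hker : (LinearMap.ker f.1).FG) : N.IsCoherentOn ⊤ := by
  intro L hL _ hfg
  have hle : LinearMap.ker f.1 ≤ L.comap f.1 := LinearMap.ker_le_comap _
  have hfg' : (L.comap f.1).FG := by
    refine Submodule.fg_of_fg_map_of_fg_inf_ker f.1 ?_ ?_
    · rwa [Submodule.map_comap_eq_of_surjective hf]
    · rwa [inf_eq_right.2 hle]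
  have := hM _ (hL.comap f) le_top hfg'
  let g : L.comap f.1 →ₗ[R] L := f.1.restrict fun x hx => hx
  refine Module.finitePresentation_of_surjective g (fun y => ?_) ?_
  · obtain ⟨x, hx⟩ := hf y
    exact ⟨⟨x, by rw [Submodule.mem_comap, hx]; exact y.2⟩, Subtype.ext hx⟩
  · have : (LinearMap.ker g).map (L.comap f.1).subtype = LinearMap.ker f.1 := by
      ext x
      constructor
      · rintro ⟨y, hy, rfl⟩
        exact congrArg Subtype.val (LinearMap.mem_ker.1 hy)
      · intro hx
        exact ⟨⟨x, hle hx⟩, LinearMap.mem_ker.2 (Subtype.ext hx), rfl⟩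
    exact Submodule.fg_of_fg_map_injective _ (Submodule.injective_subtype _) (this ▸ hker)

variable [GradedRing 𝓡]

lemma free_proj_apply {ι : Type u} {d : ι → ℤ} (n : ℕ) (x : ι →₀ R) (s : ι) :
    (show ι →₀ R from (free 𝓡 ι d).proj (n + d s) x) s = GradedRing.proj 𝓡 n (x s) := by
  let F := free 𝓡 ι d
  let ev : F.carrier →+ R := Finsupp.applyAddHom s
  have key : ∀ y : F.carrier, ∀ i, y ∈ F.deg i →
      ev (F.proj (n + d s) y) = GradedRing.proj 𝓡 n (ev y) := by
    intro y i hy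
    have hys : ev y ∈ homogDeg 𝓡 (i - d s) := mem_free_deg.1 hy s
    by_cases h : i = n + d s
    · subst h
      rw [F.proj_of_mem hy]
      have : ev y ∈ 𝓡 n := by
        rw [← mem_homogDeg_natCast]
        simpa using hys
      rw [GradedRing.proj_apply, DirectSum.decompose_of_mem_same _ this]
    · rw [F.proj_of_mem_ne h hy, map_zero]
      rcases hys with h0 | ⟨k, hk, h0⟩
      · rw [h0, map_zero]
      · rw [GradedRing.proj_apply, DirectSum.decompose_of_mem_ne _ h0]
        omega
  obtain ⟨t, ht⟩ := F.exists_eq_sum_proj x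
  change ev (F.proj (n + d s) x) = GradedRing.proj 𝓡 n (ev x)
  rw [ht]
  simp only [map_sum]
  exact Finset.sum_congr rfl fun i _ => key _ i (F.proj_mem i x)

/-- A submodule on which one coordinate is injective is isomorphic to a left ideal, homogeneous up
to the shift by `d s`. -/
lemma isCoherentOn_free_singleton (h : IsLeftGradedCoherent 𝓡) {ι : Type u} (d : ι → ℤ)
    (T : Submodule R (ι →₀ R)) (s : ι) (hT : ∀ x ∈ T, x s = 0 → x = 0) :
    (free 𝓡 ι d).IsCoherentOn T := by
  intro L hL hLT hfg
  let L' : Submodule R (ι →₀ R) := L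
  have hLT' : L' ≤ T := hLT
  let e : (ι →₀ R) →ₗ[R] R := Finsupp.lapply s
  let I : Ideal R := L'.map e
  have hI : I.IsHomogeneous 𝓡 := by
    rintro i _ ⟨x, hx, rfl⟩
    exact ⟨_, hL x hx (i + d s), free_proj_apply i x s⟩
  have hfp := h I hI (hfg.map e)
  have hinj : Function.Injective (e.submoduleMap L') := by
    rw [injective_iff_map_eq_zero]
    intro x hx
    exact Subtype.ext (hT x (hLT' x.2) (congrArg Subtype.val hx))
  exact Module.FinitePresentation.of_equiv
    (LinearEquiv.ofBijective (e.submoduleMap L')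
      ⟨hinj, LinearMap.submoduleMap_surjective e L'⟩).symm

/-- Induction on the support: the coordinate `a` maps the vectors supported in `insert a S` to a
free module of rank one, and its kernel consists of vectors supported in `S`. -/
lemma isCoherentOn_free (h : IsLeftGradedCoherent 𝓡) {ι : Type u} [Finite ι] (d : ι → ℤ) :
    (free 𝓡 ι d).IsCoherentOn ⊤ := by
  classical
  have hself : ∀ s, (free 𝓡 PUnit fun _ => d s).IsCoherentOn ⊤ := fun s =>
    isCoherentOn_free_singleton h _ ⊤ PUnit.unit fun x _ hx => Finsupp.ext fun _ => hx
  have key : ∀ S : Finset ι, (free 𝓡 ι d).IsCoherentOn (Finsupp.supported R R (S : Set ι)) := by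
    intro S
    induction S using Finset.induction_on with
    | empty =>
      intro L _ hL hfg
      have : L = ⊥ := by
        rw [eq_bot_iff]
        refine hL.trans ?_
        rw [Finset.coe_empty, Finsupp.supported_empty]
        exact le_rfl
      rw [this]
      infer_instance
    | insert a S ha ih =>
      let f : free 𝓡 ι d ⟶ free 𝓡 PUnit fun _ => d a :=
        ⟨Finsupp.lsingle PUnit.unit ∘ₗ Finsupp.lapply a, fun j x hx => mem_free_deg.2 fun s => by
          change Finsupp.single PUnit.unit _ s ∈ _
          rw [Finsupp.single_eq_same]
          exact mem_free_deg.1 hx a⟩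
      refine isCoherentOn_of_ker f (hself a) _ fun L hL hLT hfg => ih L hL (fun x hx => ?_) hfg
      have hxT := hLT hx
      have h0 : (show ι →₀ R from x) a = 0 := by
        have := LinearMap.mem_ker.1 hxT.2
        exact Finsupp.single_eq_zero.1 this
      have h1 : (show ι →₀ R from x) ∈ Finsupp.supported R R ((insert a S : Finset ι) : Set ι) :=
        hxT.1
      change (show ι →₀ R from x) ∈ Finsupp.supported R R (S : Set ι)
      rw [Finsupp.mem_supported'] at h1 ⊢
      intro i hi
      by_cases hia : i = a
      · rw [hia]; exact h0
      · refine h1 i ?_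
        rw [Finset.coe_insert, Set.mem_insert_iff]
        exact fun h => h.elim hia hi
  have := Fintype.ofFinite ι
  intro L hL _ hfg
  refine key Finset.univ L hL ?_ hfg
  intro x _
  change (show ι →₀ R from x) ∈ Finsupp.supported R R _
  rw [Finset.coe_univ, Finsupp.supported_univ]
  trivial

lemma exists_homogeneous_generators (M : GrMod 𝓡) [hM : Module.Finite R M.carrier] :
    ∃ T : Finset M.carrier, (∀ m : T, ∃ j, (m : M.carrier) ∈ M.deg j) ∧
      Submodule.span R (T : Set M.carrier) = ⊤ := by
  classical
  obtain ⟨S, hS⟩ := hM.fg_top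
  choose t ht using M.exists_eq_sum_proj
  refine ⟨S.biUnion fun x => (t x).image fun j => M.proj j x, ?_, ?_⟩
  · rintro ⟨m, hm⟩
    simp only [Finset.mem_biUnion, Finset.mem_image] at hm
    obtain ⟨x, _, j, _, rfl⟩ := hm
    exact ⟨j, M.proj_mem j x⟩
  · rw [eq_top_iff, ← hS, Submodule.span_le]
    intro x hx
    rw [SetLike.mem_coe, ht x]
    refine sum_mem fun j hj => Submodule.subset_span ?_
    simp only [Finset.coe_biUnion, Set.mem_iUnion, Finset.coe_image]
    exact ⟨x, hx, j, hj, rfl⟩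

lemma isCoherentOn_of_finitePresentation (h : IsLeftGradedCoherent 𝓡) (M : GrMod 𝓡)
    [hM : Module.FinitePresentation R M.carrier] : M.IsCoherentOn ⊤ := by
  obtain ⟨T, hT, hspan⟩ := M.exists_homogeneous_generators
  choose d hd using hT
  let f : free 𝓡 T d ⟶ M := freeDesc (fun s => (s : M.carrier)) hd
  have hf : Function.Surjective f.1 := by
    have : LinearMap.range (Finsupp.linearCombination R fun s : T => (s : M.carrier)) = ⊤ := by
      rw [Finsupp.range_linearCombination]
      exact (congrArg _ Subtype.range_coe).trans hspan
    exact LinearMap.range_eq_top.1 this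
  have : Module.Finite R (free 𝓡 T d).carrier := inferInstanceAs (Module.Finite R (T →₀ R))
  exact isCoherentOn_of_surjective f hf (isCoherentOn_free h d)
    (Module.FinitePresentation.fg_ker f.1 hf)

/-- Coherence is used twice: in `N` it makes the image finitely presented, so the kernel is finitely
generated; in `M` it then makes the kernel finitely presented. -/
lemma finitePresentation_ker (h : IsLeftGradedCoherent 𝓡) {M N : GrMod 𝓡} (f : M ⟶ N)
    [Module.FinitePresentation R M.carrier] [Module.FinitePresentation R N.carrier] :
    Module.FinitePresentation R (LinearMap.ker f.1) := by
  have : Module.FinitePresentation R (LinearMap.range f.1) :=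
    isCoherentOn_of_finitePresentation h N _ (isHomog_range f) le_top
      (LinearMap.range_eq_map f.1 ▸ Module.Finite.fg_top.map _)
  refine isCoherentOn_of_finitePresentation h M _ (isHomog_ker f) le_top ?_
  rw [← LinearMap.ker_rangeRestrict]
  exact Module.FinitePresentation.fg_ker _ f.1.surjective_rangeRestrict

lemma finitePresentation_quotient_range {M N : GrMod 𝓡} (f : M ⟶ N)
    [Module.FinitePresentation R M.carrier] [Module.FinitePresentation R N.carrier] :
    Module.FinitePresentation R (N.carrier ⧸ LinearMap.range f.1) :=
  Module.finitePresentation_of_surjective _ (Submodule.mkQ_surjective _) (by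
    rw [Submodule.ker_mkQ, LinearMap.range_eq_map]
    exact Module.Finite.fg_top.map _)

end GrMod

open GrMod

variable [GradedRing 𝓡]

/-- An isomorphism of graded modules is a linear equivalence. -/
def GrMod.linearEquivOfIso {M N : GrMod 𝓡} (e : M ≅ N) : M.carrier ≃ₗ[R] N.carrier :=
  LinearEquiv.ofLinearMap e.hom.1 e.inv.1 (congrArg Subtype.val e.inv_hom_id)
    (congrArg Subtype.val e.hom_inv_id)

instance : (isFP 𝓡).IsClosedUnderIsomorphisms where
  of_iso e h := by
    have : Module.FinitePresentation R _ := h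
    exact Module.FinitePresentation.of_equiv (linearEquivOfIso e)

instance : (isFP 𝓡).ContainsZero where
  exists_zero :=
    have : Subsingleton (GrMod.zero 𝓡).carrier := inferInstanceAs (Subsingleton PUnit)
    ⟨GrMod.zero 𝓡, isZero_of_subsingleton _, Module.FinitePresentation.of_subsingleton _⟩

instance : (isFP 𝓡).IsClosedUnderBinaryProducts where
  limitsOfShape_le := by
    rintro X ⟨p⟩
    let M := p.diag.obj ⟨WalkingPair.left⟩
    let N := p.diag.obj ⟨WalkingPair.right⟩
    have hM : Module.FinitePresentation R M.carrier := p.prop_diag_obj _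
    have hN : Module.FinitePresentation R N.carrier := p.prop_diag_obj _
    have h : isFP 𝓡 (M.prod N) := Module.FinitePresentation.prod _ _
    refine (isFP 𝓡).prop_of_iso ?_ h
    exact IsLimit.conePointsIsoOfNatIso (prodIsBilimit M N).isLimit p.isLimit
      (diagramIsoPair p.diag).symm

instance : (isFP 𝓡).IsClosedUnderFiniteProducts :=
  ObjectProperty.IsClosedUnderFiniteProducts.mk'

lemma isClosedUnderKernels_isFP (h : IsLeftGradedCoherent 𝓡) :
    (isFP 𝓡).IsClosedUnderKernels where
  kernels_le := by
    rintro _ ⟨f, k, hk, hM, hN⟩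
    have : Module.FinitePresentation R _ := hM
    have : Module.FinitePresentation R _ := hN
    have hker : isFP 𝓡 (ofSub _ _ (isHomog_ker f)) := finitePresentation_ker h f
    exact (isFP 𝓡).prop_of_iso ((GrMod.kernelIsLimit f).conePointUniqueUpToIso hk) hker

instance : (isFP 𝓡).IsClosedUnderCokernels where
  cokernels_le := by
    rintro _ ⟨f, k, hk, hM, hN⟩
    have : Module.FinitePresentation R _ := hM
    have : Module.FinitePresentation R _ := hN
    have hcoker : isFP 𝓡 (quot _ _ (isHomog_range f)) := finitePresentation_quotient_range f
    exact (isFP 𝓡).prop_of_iso ((GrMod.cokernelIsColimit f).coconePointUniqueUpToIso hk) hcoker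

theorem abelian_isFP (h : IsLeftGradedCoherent 𝓡) :
    Nonempty (Abelian (isFP 𝓡).FullSubcategory) ∧
    PreservesFiniteLimits (isFP 𝓡).ι ∧ PreservesFiniteColimits (isFP 𝓡).ι := by
  have := isClosedUnderKernels_isFP h
  have := fun X Y (f : X ⟶ Y) => (isFP 𝓡).preservesKernels_ι f
  have := fun X Y (f : X ⟶ Y) => (isFP 𝓡).preservesCokernels_ι f
  exact ⟨⟨inferInstance⟩, Functor.preservesFiniteLimits_of_preservesKernels _,
    Functor.preservesFiniteColimits_of_preservesCokernels _⟩

end FinitelyPresented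


/-! ## The linear part of a minimal resolution and maps to the residue module -/

section LinearPart

variable {K : Type v} {A : Type u} [Field K] [Ring A] [Algebra K A]
  (𝒜 : ℕ → Submodule K A) [GradedAlgebra 𝒜]

/-- The left ideal `𝔪 = ⨁_{i > 0} A_i`. -/
abbrev irrel : Ideal A := (HomogeneousIdeal.irrelevant 𝒜).toIdeal

variable {𝒜}

lemma mem_irrel {a : A} : a ∈ irrel 𝒜 ↔ GradedRing.proj 𝒜 0 a = 0 :=
  HomogeneousIdeal.mem_irrelevant_iff 𝒜 a

lemma mul_mem_irrel_right {a b : A} (ha : a ∈ irrel 𝒜) : a * b ∈ irrel 𝒜 := by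
  have ha' : GradedRing.projZeroRingHom 𝒜 a = 0 := mem_irrel.1 ha
  refine mem_irrel.2 ?_
  change GradedRing.projZeroRingHom 𝒜 (a * b) = 0
  rw [map_mul, ha', zero_mul]

lemma mem_irrel_of_mem {i : ℕ} (hi : 0 < i) {a : A} (ha : a ∈ 𝒜 i) : a ∈ irrel 𝒜 :=
  HomogeneousIdeal.mem_irrelevant_of_mem 𝒜 hi ha

lemma eq_zero_of_mem_irrel {a : A} (h : a ∈ irrel 𝒜) (h0 : a ∈ 𝒜 0) : a = 0 := by
  rw [mem_irrel, GradedRing.proj_apply, DirectSum.decompose_of_mem_same _ h0] at h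
  exact h

variable (𝒜) in
/-- The projection to the component of degree one. -/
def projOne : A →ₗ[K] 𝒜 1 :=
  DirectSum.component K ℕ (fun i => 𝒜 i) 1 ∘ₗ (DirectSum.decomposeLinearEquiv 𝒜).toLinearMap

lemma coe_projOne (a : A) : (projOne 𝒜 a : A) = GradedRing.proj 𝒜 1 a := rfl

/-- Elements of `𝔪²` start in degree two. Hence a functional on `A_1` gives a functional on `𝔪/𝔪²`,
which is what `irrelToResidue` needs. -/
lemma projOne_mul_eq_zero {a b : A} (ha : a ∈ irrel 𝒜) (hb : b ∈ irrel 𝒜) :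
    projOne 𝒜 (a * b) = 0 := by
  classical
  apply Subtype.ext
  rw [mem_irrel, GradedRing.proj_apply] at ha hb
  rw [coe_projOne, GradedRing.proj_apply, ZeroMemClass.coe_zero,
    ← DirectSum.sum_support_decompose 𝒜 a, Finset.sum_mul, DirectSum.decompose_sum,
    DFinsupp.finsetSum_apply, Submodule.coe_sum]
  refine Finset.sum_eq_zero fun i _ => ?_
  have hi : ((DirectSum.decompose 𝒜 a i : 𝒜 i) : A) ∈ 𝒜 i := Subtype.prop _
  rcases Nat.lt_or_ge 1 i with h | h
  · exact DirectSum.coe_decompose_mul_of_left_mem_of_not_le 𝒜 hi (by omega)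
  · rw [DirectSum.coe_decompose_mul_of_left_mem_of_le 𝒜 hi h]
    obtain rfl | rfl : i = 0 ∨ i = 1 := by omega
    · rw [ha, zero_mul]
    · rw [Nat.sub_self, hb, mul_zero]

variable (h_zero : Function.Bijective (algebraMap K (𝒜 0)))

include h_zero

lemma algebraMap_injective : Function.Injective (algebraMap K A) := fun _ _ h =>
  h_zero.1 (Subtype.ext h)

lemma exists_sub_algebraMap_mem (a : A) : ∃ c : K, a - algebraMap K A c ∈ irrel 𝒜 := by
  obtain ⟨c, hc⟩ := h_zero.2 (DirectSum.decompose 𝒜 a 0)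
  refine ⟨c, mem_irrel.2 ?_⟩
  have hc' : algebraMap K A c = (DirectSum.decompose 𝒜 a 0 : 𝒜 0) := congrArg Subtype.val hc
  rw [hc', map_sub, GradedRing.proj_apply, GradedRing.proj_apply,
    DirectSum.decompose_of_mem_same 𝒜 (Subtype.prop _), sub_self]

lemma exists_residue_eq (y : ResidueModule 𝒜) :
    ∃ c : K, y = (irrel 𝒜).mkQ (algebraMap K A c) := by
  obtain ⟨a, rfl⟩ := (irrel 𝒜).mkQ_surjective y
  obtain ⟨c, hc⟩ := exists_sub_algebraMap_mem h_zero a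
  exact ⟨c, (Submodule.Quotient.eq _).2 hc⟩

lemma eq_zero_of_algebraMap_mem {c : K} (h : algebraMap K A c ∈ irrel 𝒜) : c = 0 := by
  have := eq_zero_of_mem_irrel h (SetLike.algebraMap_mem_graded 𝒜 c)
  exact algebraMap_injective h_zero (by rw [this, map_zero])

/-- The `A`-linear map `𝔪 → A/𝔪` given by a linear functional on `A_1`. -/
def irrelToResidue (φ : 𝒜 1 →ₗ[K] K) : irrel 𝒜 →ₗ[A] ResidueModule 𝒜 where
  toFun x := (irrel 𝒜).mkQ (algebraMap K A (φ (projOne 𝒜 x)))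
  map_add' x y := by simp only [Submodule.coe_add, map_add]
  map_smul' a x := by
    -- Both on the degree one part of `𝔪` and on `A/𝔪`, `a` acts through its constant term `c`.
    obtain ⟨c, hc⟩ := exists_sub_algebraMap_mem h_zero a
    have h1 : projOne 𝒜 ((a - algebraMap K A c) * x) = 0 := projOne_mul_eq_zero hc x.2
    have h2 : projOne 𝒜 (a * x) = c • projOne 𝒜 x := by
      rwa [sub_mul, map_sub, ← Algebra.smul_def, map_smul, sub_eq_zero] at h1
    rw [Submodule.coe_smul, smul_eq_mul, h2, RingHom.id_apply, ← map_smul (irrel 𝒜).mkQ, map_smul,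
      smul_eq_mul, map_mul, smul_eq_mul]
    refine ((Submodule.Quotient.eq _).2 ?_).symm
    rw [← sub_mul]
    exact mul_mem_irrel_right hc

omit h_zero

lemma linearMap_apply_mem_irrel {ι κ : Type*} (f : (ι →₀ A) →ₗ[A] (κ →₀ A))
    (h : ∀ s t, f (Finsupp.single s 1) t ∈ irrel 𝒜) (z : ι →₀ A) (t : κ) :
    f z t ∈ irrel 𝒜 := by
  induction z using Finsupp.induction_linear with
  | zero => simp
  | add x y hx hy => rw [map_add, Finsupp.add_apply]; exact add_mem hx hy
  | single s a =>
    rw [← mul_one a, ← smul_eq_mul, ← Finsupp.smul_single, map_smul, Finsupp.smul_apply]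
    exact Ideal.mul_mem_left _ _ (h s t)

namespace GradedFreeResolution

variable {M : GrMod 𝒜} (P : GradedFreeResolution M)

variable {P} in
lemma IsMinimal.d_apply_mem (hP : P.IsMinimal) (i : ℕ) (z : P.ι (i + 1) →₀ A) (t : P.ι i) :
    P.d i z t ∈ irrel 𝒜 :=
  linearMap_apply_mem_irrel _ (fun s t => hP i s t) z t

lemma lin_single (i : ℕ) (s : P.ι (i + 1)) :
    P.lin i (Finsupp.single s 1) =
      (P.d i (Finsupp.single s 1)).filter fun t => P.deg (i + 1) s - P.deg i t < 2 := by
  rw [lin, Finsupp.linearCombination_single, one_smul]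

variable {P} in
lemma IsMinimal.lin_apply_mem (hP : P.IsMinimal) (i : ℕ) (z : P.ι (i + 1) →₀ A) (t : P.ι i) :
    P.lin i z t ∈ irrel 𝒜 := by
  refine linearMap_apply_mem_irrel _ (fun s t => ?_) z t
  rw [lin_single, Finsupp.filter_apply]
  split_ifs
  · exact hP i s t
  · exact zero_mem _

variable {P} in
-- The filter in `lin` keeps the entries of degree at most one; minimality forces those of degree
-- zero to vanish.
lemma IsMinimal.lin_single_apply (hP : P.IsMinimal) (i : ℕ) (s : P.ι (i + 1)) (t : P.ι i) :
    P.lin i (Finsupp.single s 1) t = projOne 𝒜 (P.d i (Finsupp.single s 1) t) := by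
  rw [lin_single, Finsupp.filter_apply, coe_projOne, GradedRing.proj_apply]
  rcases P.d_homogeneous i s t with h | ⟨k, hk, h⟩
  · simp [h]
  · rcases Nat.lt_trichotomy k 1 with hk1 | rfl | hk1
    · obtain rfl : k = 0 := by omega
      have h0 := eq_zero_of_mem_irrel (hP i s t) h
      simp [h0]
    · rw [if_pos (by omega), DirectSum.decompose_of_mem_same _ h]
    · rw [if_neg (by omega), DirectSum.decompose_of_mem_ne _ h (by omega)]

include h_zero

/-- The linear columns are independent over `K`, so the values of `f` on generators extend to a
`K`-linear functional `h` on `P_a`. Expanding its restriction to `A_1`-coefficients in a basis of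
`A_1` gives the finite sum. -/
lemma exists_factorization [Module.Finite K (𝒜 1)] (hP : P.IsMinimal) (a : ℕ)
    (hlin : LinearMap.ker (P.lin a) ≤ LinearMap.range (P.lin (a + 1)))
    (f : LinearMap.range (P.d a) →ₗ[A] ResidueModule 𝒜) :
    ∃ (r : ℕ) (l : Fin r → (irrel 𝒜 →ₗ[A] ResidueModule 𝒜))
      (G : Fin r → ((P.ι a →₀ A) →ₗ[A] A))
      (hG : ∀ k, ∀ x ∈ LinearMap.range (P.d a), G k x ∈ irrel 𝒜),
      ∀ x : LinearMap.range (P.d a), ∑ k, l k ⟨G k x, hG k x x.2⟩ = f x := by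
  classical
  choose φ hφ using fun s => exists_residue_eq h_zero
    (f ⟨P.d a (Finsupp.single s 1), LinearMap.mem_range_self _ _⟩)
  let Λ : (P.ι (a + 1) →₀ K) →ₗ[K] (P.ι a →₀ A) :=
    Finsupp.linearCombination K fun s => P.lin a (Finsupp.single s 1)
  have hΛ : ∀ c, Λ c = P.lin a (c.mapRange (algebraMap K A) (map_zero _)) := by
    intro c
    induction c using Finsupp.induction_linear with
    | zero => simp
    | add x y hx hy =>
      rw [map_add, hx, hy, Finsupp.mapRange_add (fun _ _ => map_add _ _ _), map_add]
    | single s c =>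
      rw [Finsupp.mapRange_single, ← mul_one (algebraMap K A c), ← smul_eq_mul,
        ← Finsupp.smul_single, map_smul, algebraMap_smul]
      exact Finsupp.linearCombination_single _ _ _
  have hker : LinearMap.ker Λ = ⊥ := by
    rw [LinearMap.ker_eq_bot']
    intro c hc
    rw [hΛ] at hc
    -- A scalar relation between the columns is a cycle of `lin P`, hence a boundary. Boundaries
    -- have entries in `𝔪`, and a scalar in `𝔪` is zero.
    obtain ⟨z, hz⟩ := hlin (LinearMap.mem_ker.2 hc)
    ext s
    refine eq_zero_of_algebraMap_mem h_zero ?_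
    rw [← Finsupp.mapRange_apply (hf := map_zero (algebraMap K A)), ← hz]
    exact hP.lin_apply_mem _ _ _
  obtain ⟨Λ', hΛ'⟩ := LinearMap.exists_leftInverse_of_injective Λ hker
  let h : (P.ι a →₀ A) →ₗ[K] K := Finsupp.linearCombination K φ ∘ₗ Λ'
  have hh : ∀ s, h (P.lin a (Finsupp.single s 1)) = φ s := by
    intro s
    have h1 : P.lin a (Finsupp.single s 1) = Λ (Finsupp.single s 1) := by
      rw [hΛ, Finsupp.mapRange_single, map_one]
    have h2 : Λ' (Λ (Finsupp.single s 1)) = Finsupp.single s 1 := LinearMap.congr_fun hΛ' _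
    rw [h1]
    change Finsupp.linearCombination K φ (Λ' (Λ _)) = _
    rw [h2, Finsupp.linearCombination_single, one_smul]
  let b := Module.finBasis K (𝒜 1)
  -- These scalars are the matrix of `h` on `A_1`-valued vectors: `h (single t y) = ∑ k, c k t *
  -- b.coord k y` for `y ∈ A_1`.
  let c : Fin (Module.finrank K (𝒜 1)) → P.ι a → K := fun k t => h (Finsupp.single t (b k))
  let l : Fin (Module.finrank K (𝒜 1)) → (irrel 𝒜 →ₗ[A] ResidueModule 𝒜) :=
    fun k => irrelToResidue h_zero (b.coord k)
  let G : Fin (Module.finrank K (𝒜 1)) → ((P.ι a →₀ A) →ₗ[A] A) :=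
    fun k => Finsupp.linearCombination A fun t => algebraMap K A (c k t)
  have hG : ∀ k, ∀ x ∈ LinearMap.range (P.d a), G k x ∈ irrel 𝒜 := by
    rintro k _ ⟨z, rfl⟩
    exact sum_mem fun t _ => mul_mem_irrel_right (hP.d_apply_mem a z t)
  refine ⟨_, l, G, hG, ?_⟩
  let lhs : (P.ι (a + 1) →₀ A) →ₗ[A] ResidueModule 𝒜 :=
    ∑ k, l k ∘ₗ ((G k ∘ₗ P.d a).codRestrict (irrel 𝒜) fun z => hG k _ ⟨z, rfl⟩)
  have hlhs : lhs = f ∘ₗ (P.d a).rangeRestrict := by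
    refine Finsupp.lhom_ext' fun s => LinearMap.ext_ring ?_
    set x : P.ι a →₀ A := P.d a (Finsupp.single s 1) with hx
    have h3 : P.lin a (Finsupp.single s 1) =
        x.mapRange (fun y => (projOne 𝒜 y : A)) (by simp) := by
      ext t
      rw [Finsupp.mapRange_apply]
      exact hP.lin_single_apply a s t
    have h4 : ∀ k, projOne 𝒜 (G k x) = x.sum fun t y => c k t • projOne 𝒜 y := by
      intro k
      rw [Finsupp.linearCombination_apply, map_finsuppSum]
      refine Finsupp.sum_congr fun t _ => ?_
      rw [smul_eq_mul, ← Algebra.commutes, ← Algebra.smul_def, map_smul]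
    have h5 : ∑ k, b.coord k (projOne 𝒜 (G k x)) = φ s := by
      rw [← hh s, h3]
      have h6 : x.mapRange (fun y => (projOne 𝒜 y : A)) (by simp) =
          x.sum fun t y => Finsupp.single t (projOne 𝒜 y : A) := by
        conv_lhs => rw [← Finsupp.sum_single (x.mapRange _ _)]
        rw [Finsupp.sum_mapRange_index fun t => Finsupp.single_zero t]
      rw [h6, map_finsuppSum]
      simp only [h4, map_finsuppSum, map_smul, smul_eq_mul]
      simp only [Finsupp.sum]
      rw [Finset.sum_comm]
      refine Finset.sum_congr rfl fun t _ => ?_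
      have h7 : Finsupp.single t (projOne 𝒜 (x t) : A) =
          ∑ k, b.coord k (projOne 𝒜 (x t)) • Finsupp.single t (b k : A) := by
        conv_lhs => rw [← b.sum_repr (projOne 𝒜 (x t))]
        rw [Submodule.coe_sum, ← Finsupp.lsingle_apply (R := K), map_sum]
        refine Finset.sum_congr rfl fun k _ => ?_
        rw [Submodule.coe_smul, map_smul]
        rfl
      rw [h7, map_sum]
      refine Finset.sum_congr rfl fun k _ => ?_
      rw [map_smul, smul_eq_mul, mul_comm]
    change lhs (Finsupp.single s 1) = f ⟨x, _⟩
    rw [hφ s, ← h5, map_sum, map_sum, LinearMap.sum_apply]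
    rfl
  rintro ⟨_, z, rfl⟩
  have := LinearMap.congr_fun hlhs z
  rw [LinearMap.sum_apply] at this
  exact this

end GradedFreeResolution

end LinearPart


/-! ## Syzygies and extension groups -/

section ShortExactSequences

variable {A : Type u} [Ring A]
  {P Y : Type u} [AddCommGroup P] [Module A P] [AddCommGroup Y] [Module A Y]
  {P' Y' : Type u} [AddCommGroup P'] [Module A P'] [AddCommGroup Y'] [Module A Y']

/-- The short complex `Z → P → Y` given by the kernel `Z` of a linear map. -/
abbrev kerComplex (Z : Submodule A P) (c : P →ₗ[A] Y) (h : LinearMap.ker c = Z) :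
    ShortComplex (ModuleCat.{u} A) where
  X₁ := ModuleCat.of A Z
  X₂ := ModuleCat.of A P
  X₃ := ModuleCat.of A Y
  f := ModuleCat.ofHom Z.subtype
  g := ModuleCat.ofHom c
  zero := by
    ext x
    exact LinearMap.mem_ker.1 (h.ge x.2)

variable {Z : Submodule A P} {c : P →ₗ[A] Y} (h : LinearMap.ker c = Z)
  {Z' : Submodule A P'} {c' : P' →ₗ[A] Y'} (h' : LinearMap.ker c' = Z')

lemma kerComplex_shortExact (hc : Function.Surjective c) : (kerComplex Z c h).ShortExact := by
  subst h
  exact LinearMap.shortExact_shortComplexKer hc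

/-- `G` induces a morphism of short exact sequences, and extension classes are natural. -/
lemma exists_extClass_comp_mk₀_eq (hc : Function.Surjective c) (hc' : Function.Surjective c')
    (G : P →ₗ[A] P') (hG : ∀ x ∈ Z, G x ∈ Z') :
    ∃ q : Y →ₗ[A] Y', (∀ x, q (c x) = c' (G x)) ∧
      (kerComplex_shortExact h hc).extClass.comp
        (Ext.mk₀ (ModuleCat.ofHom (G.restrict hG))) (add_zero 1) =
      (Ext.mk₀ (ModuleCat.ofHom q)).comp (kerComplex_shortExact h' hc').extClass (zero_add 1) := by
  have hle : LinearMap.ker c ≤ LinearMap.ker (c' ∘ₗ G) := by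
    rw [h, LinearMap.ker_comp, h']
    exact hG
  let q : Y →ₗ[A] Y' := (LinearMap.ker c).liftQ (c' ∘ₗ G) hle ∘ₗ
    (c.quotKerEquivOfSurjective hc).symm.toLinearMap
  have hq : ∀ x, q (c x) = c' (G x) := by
    intro x
    have : (c.quotKerEquivOfSurjective hc).symm (c x) = (LinearMap.ker c).mkQ x := by
      rw [LinearEquiv.symm_apply_eq]
      rfl
    change (LinearMap.ker c).liftQ (c' ∘ₗ G) hle ((c.quotKerEquivOfSurjective hc).symm (c x)) = _
    rw [this]
    rfl
  refine ⟨q, hq, ?_⟩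
  let φ : kerComplex Z c h ⟶ kerComplex Z' c' h' :=
    { τ₁ := ModuleCat.ofHom (G.restrict hG)
      τ₂ := ModuleCat.ofHom G
      τ₃ := ModuleCat.ofHom q
      comm₁₂ := rfl
      comm₂₃ := by ext x; exact (hq x).symm }
  exact ShortComplex.ShortExact.extClass_naturality (kerComplex_shortExact h hc)
    (kerComplex_shortExact h' hc') φ

/-- Dimension shifting: the positive `Ext` groups of the projective middle term vanish. -/
lemma exists_extClass_comp_eq [Module.Projective A P] (hc : Function.Surjective c)
    {X : ModuleCat.{u} A} {n : ℕ} (x : Ext (ModuleCat.of A Y) X (n + 1)) :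
    ∃ y : Ext (ModuleCat.of A Z) X n,
      (kerComplex_shortExact h hc).extClass.comp y (add_comm 1 n) = x := by
  have : Projective (kerComplex Z c h).X₂ := (IsProjective.iff_projective P).1 inferInstance
  exact Ext.contravariant_sequence_exact₃ (kerComplex_shortExact h hc) X x
    (Ext.eq_zero_of_projective _) (add_comm 1 n)

lemma eq_zero_of_extClass_comp [Module.Projective A P] (hc : Function.Surjective c)
    {X : ModuleCat.{u} A} {n m : ℕ} (y : Ext (ModuleCat.of A Z) X (n + 1)) (hm : 1 + (n + 1) = m)
    (hy : (kerComplex_shortExact h hc).extClass.comp y hm = 0) : y = 0 := by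
  have : Projective (kerComplex Z c h).X₂ := (IsProjective.iff_projective P).1 inferInstance
  obtain ⟨x, rfl⟩ := Ext.contravariant_sequence_exact₁ (kerComplex_shortExact h hc) X y hm hy
  rw [Ext.eq_zero_of_projective (P := (kerComplex Z c h).X₂) x, Ext.comp_zero]

end ShortExactSequences

/-! ### Iterated syzygies and generation of `Ext` by `Ext^1`. -/

section Syzygies

variable {K : Type v} {A : Type u} [Field K] [Ring A] [Algebra K A]
  {𝒜 : ℕ → Submodule K A} [GradedAlgebra 𝒜]

variable (𝒜) in
/-- The residue module `A/𝔪` as an object of the category of modules. -/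
abbrev residue : ModuleCat.{u} A := ModuleCat.of A (ResidueModule 𝒜)

namespace GradedFreeResolution

variable {M : GrMod 𝒜} (P : GradedFreeResolution M)

/-- The underlying type of the `i`-th syzygy module of a resolution. -/
def syz : ℕ → ModuleCat.{u} A
  | 0 => ModuleCat.of A M.carrier
  | i + 1 => ModuleCat.of A (LinearMap.range (P.d i))

/-- The free cover of the `i`-th syzygy module. -/
def cover : (i : ℕ) → (P.ι i →₀ A) →ₗ[A] P.syz i
  | 0 => P.aug
  | i + 1 => (P.d i).rangeRestrict

lemma cover_surjective (i : ℕ) : Function.Surjective (P.cover i) := by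
  cases i with
  | zero => exact P.aug_surjective
  | succ i => exact (P.d i).surjective_rangeRestrict

lemma ker_cover (i : ℕ) : LinearMap.ker (P.cover i) = LinearMap.range (P.d i) := by
  cases i with
  | zero => exact P.exact_aug.linearMap_ker_eq
  | succ i => exact ((P.d i).ker_rangeRestrict).trans (P.exact_d i).linearMap_ker_eq

/-- The class of the extension `0 → Z_{i+1} → P_i → Z_i → 0`. -/
def syzClass (i : ℕ) : Ext (P.syz i) (P.syz (i + 1)) 1 :=
  (kerComplex_shortExact (P.ker_cover i) (P.cover_surjective i)).extClass

variable {P} in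
lemma exists_syzClass_comp_eq {X : ModuleCat.{u} A} {i n : ℕ} (x : Ext (P.syz i) X (n + 1)) :
    ∃ y : Ext (P.syz (i + 1)) X n, (P.syzClass i).comp y (add_comm 1 n) = x :=
  exists_extClass_comp_eq (P.ker_cover i) (P.cover_surjective i) x

variable {P} in
lemma eq_zero_of_syzClass_comp {X : ModuleCat.{u} A} {i n m : ℕ}
    (y : Ext (P.syz (i + 1)) X (n + 1)) (hm : 1 + (n + 1) = m)
    (h : (P.syzClass i).comp y hm = 0) : y = 0 :=
  eq_zero_of_extClass_comp (P.ker_cover i) (P.cover_surjective i) y hm h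

/-- `δ` is the product of the first `n` syzygy classes. Injectivity is claimed only in positive
degree: in degree zero, maps that extend to the free cover are killed. -/
lemma exists_syzClass_iterate (n : ℕ) :
    ∃ δ : Ext (P.syz 0) (P.syz n) n,
      (∀ (X : ModuleCat.{u} A) (i m : ℕ) (hm : n + i = m) (x : Ext (P.syz 0) X m),
        ∃ y : Ext (P.syz n) X i, δ.comp y hm = x) ∧
      (∀ (X : ModuleCat.{u} A) (i m : ℕ) (hm : n + (i + 1) = m) (y : Ext (P.syz n) X (i + 1)),
        δ.comp y hm = 0 → y = 0) := by
  induction n with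
  | zero =>
    refine ⟨Ext.mk₀ (𝟙 _), ?_, ?_⟩
    · intro X i m hm x
      obtain rfl : i = m := by omega
      exact ⟨x, Ext.mk₀_id_comp x⟩
    · intro X i m hm y hy
      obtain rfl : i + 1 = m := by omega
      rwa [Ext.mk₀_id_comp] at hy
  | succ n ih =>
    obtain ⟨δ, h1, h2⟩ := ih
    refine ⟨δ.comp (P.syzClass n) rfl, ?_, ?_⟩
    · intro X i m hm x
      obtain ⟨y, rfl⟩ := h1 X (i + 1) m (by omega) x
      obtain ⟨z, rfl⟩ := exists_syzClass_comp_eq y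
      exact ⟨z, Ext.comp_assoc _ _ _ _ _ (by omega)⟩
    · intro X i m hm y hy
      rw [Ext.comp_assoc (a₂₃ := i + 1 + 1) _ _ _ _ (by omega) (by omega)] at hy
      exact eq_zero_of_syzClass_comp _ _ (h2 X (i + 1) m (by omega) _ hy)

end GradedFreeResolution

/-- `Ext^{i+1}(Y, A/𝔪)` is generated by `Ext^i(Y, A/𝔪)` under left Yoneda multiplication by
`Ext^1(A/𝔪, A/𝔪)`. -/
def ExtGenerated (𝒜 : ℕ → Submodule K A) [GradedAlgebra 𝒜] (Y : ModuleCat.{u} A) (i : ℕ) : Prop :=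
  ∀ x : Ext Y (residue 𝒜) (i + 1), ∃ (r : ℕ) (g : Fin r → Ext Y (residue 𝒜) i)
    (ξ : Fin r → Ext (residue 𝒜) (residue 𝒜) 1), x = ∑ k, (g k).comp (ξ k) rfl

variable (𝒜) in
/-- The class of the extension `0 → 𝔪 → A → A/𝔪 → 0`. -/
def residueClass : Ext (residue 𝒜) (ModuleCat.of A (irrel 𝒜)) 1 :=
  (kerComplex_shortExact (irrel 𝒜).ker_mkQ (irrel 𝒜).mkQ_surjective).extClass

/-- Since `G k` is defined on all of `P`, it maps the given extension to `0 → 𝔪 → A → A/𝔪 → 0`.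
Pushing out along `f` thus gives a sum of products of maps `Y → A/𝔪` with elements of `Ext^1(A/𝔪,
A/𝔪)`. -/
lemma exists_extClass_comp_eq_sum {P Y : Type u} [AddCommGroup P] [Module A P] [AddCommGroup Y]
    [Module A Y] {Z : Submodule A P} {c : P →ₗ[A] Y} (h : LinearMap.ker c = Z)
    (hc : Function.Surjective c) (f : Z →ₗ[A] ResidueModule 𝒜) {r : ℕ}
    (l : Fin r → (irrel 𝒜 →ₗ[A] ResidueModule 𝒜)) (G : Fin r → (P →ₗ[A] A))
    (hG : ∀ k, ∀ x ∈ Z, G k x ∈ irrel 𝒜) (hf : ∀ x : Z, ∑ k, l k ⟨G k x, hG k x x.2⟩ = f x) :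
    ∃ q : Fin r → (Y →ₗ[A] ResidueModule 𝒜),
      (kerComplex_shortExact h hc).extClass.comp (Ext.mk₀ (ModuleCat.ofHom f)) (add_zero 1) =
      ∑ k, (Ext.mk₀ (ModuleCat.ofHom (q k))).comp
        ((residueClass 𝒜).comp (Ext.mk₀ (ModuleCat.ofHom (l k))) (add_zero 1)) (zero_add 1) := by
  choose q _ hq using fun k => exists_extClass_comp_mk₀_eq h
    (irrel 𝒜).ker_mkQ hc (irrel 𝒜).mkQ_surjective (G k) (hG k)
  refine ⟨q, ?_⟩
  have hf' : ModuleCat.ofHom f =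
      ∑ k, ModuleCat.ofHom ((G k).restrict (hG k)) ≫ ModuleCat.ofHom (l k) := by
    ext x
    rw [ModuleCat.hom_sum, LinearMap.sum_apply]
    exact (hf x).symm
  rw [hf', Ext.mk₀_sum, Ext.comp_sum]
  refine Finset.sum_congr rfl fun k _ => ?_
  rw [← Ext.mk₀_comp_mk₀, ← Ext.comp_assoc_of_third_deg_zero]
  exact (congrArg (fun z => Ext.comp z (Ext.mk₀ (ModuleCat.ofHom (l k))) (add_zero 1))
    (hq k)).trans (Ext.comp_assoc _ _ _ _ _ (by omega))

namespace GradedFreeResolution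

variable {M : GrMod 𝒜} {P : GradedFreeResolution M}

/-- Dimension shifting replaces `(a, j + 1)` by `(a + 1, j)`, which leaves the homological index `a
+ j + 1` fixed. At `j = 0` the factorization of maps out of `Z_{a+1}` applies. -/
lemma IsMinimal.extGenerated_syz (h_zero : Function.Bijective (algebraMap K (𝒜 0)))
    [Module.Finite K (𝒜 1)] (hP : P.IsMinimal) (j : ℕ) :
    ∀ a : ℕ, ¬ P.LinHomologyNeZero (a + j + 1) → ExtGenerated 𝒜 (P.syz a) j := by
  induction j with
  | zero =>
    intro a ha x
    obtain ⟨y, rfl⟩ := exists_syzClass_comp_eq x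
    obtain ⟨f, rfl⟩ := (Ext.mk₀_bijective _ _).2 y
    have hlin : LinearMap.ker (P.lin a) ≤ LinearMap.range (P.lin (a + 1)) := not_not.1 ha
    obtain ⟨r, l, G, hG, hf⟩ := P.exists_factorization h_zero hP a hlin f.hom
    obtain ⟨q, hq⟩ := exists_extClass_comp_eq_sum (P.ker_cover a) (P.cover_surjective a)
      f.hom l G hG hf
    exact ⟨r, fun k => Ext.mk₀ (ModuleCat.ofHom (q k)),
      fun k => (residueClass 𝒜).comp (Ext.mk₀ (ModuleCat.ofHom (l k))) (add_zero 1), hq⟩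
  | succ j ih =>
    intro a ha x
    obtain ⟨y, rfl⟩ := exists_syzClass_comp_eq x
    obtain ⟨r, g, ξ, rfl⟩ := ih (a + 1) (by rwa [show a + 1 + j + 1 = a + (j + 1) + 1 by omega]) y
    refine ⟨r, fun k => (P.syzClass a).comp (g k) (add_comm 1 j), ξ, ?_⟩
    rw [Ext.comp_sum]
    refine Finset.sum_congr rfl fun k _ => ?_
    exact (Ext.comp_assoc _ _ _ _ _ (by omega)).symm

end GradedFreeResolution

end Syzygies


/-! ## A criterion for graded coherence -/

section CoherenceCriterion

variable {B : Type u} {σ : Type v} [Ring B] [SetLike σ B] [AddSubgroupClass σ B]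

lemma exists_homogeneous_ideal_generators (𝓑 : ℕ → σ) [GradedRing 𝓑] {I : Ideal B}
    (hI : I.IsHomogeneous 𝓑) (hfg : I.FG) :
    ∃ T : Finset B, (∀ t : T, ∃ n, (t : B) ∈ 𝓑 n) ∧ Ideal.span (T : Set B) = I := by
  classical
  obtain ⟨S, rfl⟩ := hfg
  refine ⟨S.biUnion fun x => (DFinsupp.support (DirectSum.decompose 𝓑 x)).image
    fun i => (DirectSum.decompose 𝓑 x i : B), ?_, le_antisymm ?_ ?_⟩
  · rintro ⟨t, ht⟩
    simp only [Finset.mem_biUnion, Finset.mem_image] at ht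
    obtain ⟨x, _, i, _, rfl⟩ := ht
    exact ⟨i, (DirectSum.decompose 𝓑 x i).2⟩
  · rw [Ideal.span_le]
    intro t ht
    simp only [Finset.coe_biUnion, Set.mem_iUnion, Finset.coe_image] at ht
    obtain ⟨x, hx, i, _, rfl⟩ := ht
    exact hI i (Submodule.subset_span hx)
  · rw [Submodule.span_le]
    intro x hx
    rw [SetLike.mem_coe, ← DirectSum.sum_support_decompose 𝓑 x]
    refine sum_mem fun i hi => Submodule.subset_span ?_
    simp only [Finset.coe_biUnion, Set.mem_iUnion, Finset.coe_image]
    exact ⟨x, hx, i, hi, rfl⟩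

/-- Every element of `B_{n+1}` is a sum of products of elements of `B_1` and of `B_n`. -/
def GeneratedInDegreeOne (𝓑 : ℕ → σ) : Prop :=
  ∀ n, ∀ x ∈ 𝓑 (n + 1), ∃ (r : ℕ) (ξ y : Fin r → B), (∀ k, ξ k ∈ 𝓑 1) ∧ (∀ k, y k ∈ 𝓑 n) ∧
    x = ∑ k, ξ k * y k

/-- In large degrees, the relations between the elements `u k` arise from relations of smaller
degree. -/
def RelationsGenerated (𝓑 : ℕ → σ) {κ : Type u} [Fintype κ] (u : κ → B) : Prop :=
  ∃ d : ℕ, ∀ i, d ≤ i → ∀ b : κ → B, (∀ k, b k ∈ 𝓑 (i + 1)) → ∑ k, b k * u k = 0 →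
    ∃ (r : ℕ) (ξ : Fin r → B) (b' : Fin r → κ → B), (∀ l, ξ l ∈ 𝓑 1) ∧
      (∀ l k, b' l k ∈ 𝓑 i) ∧ (∀ l, ∑ k, b' l k * u k = 0) ∧ ∀ k, b k = ∑ l, ξ l * b' l k

variable {𝓑 : ℕ → σ} [GradedRing 𝓑]

lemma exists_eq_sum_mul_of_mem (hgen : GeneratedInDegreeOne 𝓑) (e t : ℕ) :
    ∀ x ∈ 𝓑 (t + e), ∃ (r : ℕ) (z y : Fin r → B), (∀ k, z k ∈ 𝓑 t) ∧ (∀ k, y k ∈ 𝓑 e) ∧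
      x = ∑ k, z k * y k := by
  induction t with
  | zero =>
    intro x hx
    exact ⟨1, fun _ => 1, fun _ => x, fun _ => SetLike.one_mem_graded 𝓑,
      fun _ => by rwa [Nat.zero_add] at hx, by simp⟩
  | succ t ih =>
    intro x hx
    obtain ⟨r, ξ, y, hξ, hy, rfl⟩ := hgen (t + e) x (by rwa [show t + e + 1 = t + 1 + e by omega])
    choose s z w hz hw h using fun k => ih (y k) (hy k)
    let E := finSigmaFinEquiv (n := s)
    refine ⟨_, fun p => ξ (E.symm p).1 * z _ (E.symm p).2, fun p => w _ (E.symm p).2,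
      fun p => ?_, fun p => hw _ _, ?_⟩
    · rw [Nat.add_comm t 1]
      exact SetLike.mul_mem_graded (hξ _) (hz _ _)
    · rw [E.symm.sum_comp fun p => ξ p.1 * z _ p.2 * w _ p.2, Fintype.sum_sigma]
      refine Finset.sum_congr rfl fun k _ => ?_
      conv_lhs => rw [h k, Finset.mul_sum]
      exact Finset.sum_congr rfl fun j _ => (mul_assoc _ _ _).symm

variable {K : Type*} [Field K] (ρ : K →+* B) (hρ : ∀ c, ρ c ∈ 𝓑 0)
  (hfin : ∀ n, ∃ (r : ℕ) (w : Fin r → B), (∀ j, w j ∈ 𝓑 n) ∧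
    ∀ x ∈ 𝓑 n, ∃ c : Fin r → K, x = ∑ j, ρ (c j) * w j)
  (hgen : GeneratedInDegreeOne 𝓑)
  (hrel : ∀ n, 1 ≤ n → ∀ {κ : Type u} [Fintype κ] (u : κ → B), (∀ k, u k ∈ 𝓑 n) →
    RelationsGenerated 𝓑 u)

include hfin in
/-- The span of elements of bounded degrees is small. -/
lemma fg_of_bounded_degree {ι : Type*} [Finite ι] (S : Submodule B (ι → B)) (D : ℕ)
    (hS : S = Submodule.span B {c | c ∈ S ∧ ∀ t, ∃ j ≤ D, c t ∈ 𝓑 j}) : S.FG := by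
  classical
  -- The generators of bounded degree lie in a finite-dimensional `K`-space, and a `K`-basis of its
  -- intersection with `S` generates `S` over `B`.
  let : Module K B := Module.compHom B ρ
  have smul_def : ∀ (c : K) (b : B), c • b = ρ c * b := fun _ _ => rfl
  have : IsScalarTower K B (ι → B) := ⟨fun c b x => funext fun t => by
    simp only [Pi.smul_apply, smul_eq_mul, smul_def, mul_assoc]⟩
  choose r w hw hspan using hfin
  let V : Submodule K B := ⨆ j : Fin (D + 1), Submodule.span K (Set.range (w j))
  have hV : V.FG := Submodule.fg_iSup _ fun j => Submodule.fg_span (Set.finite_range _)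
  have hmem : ∀ j ≤ D, ∀ x ∈ 𝓑 j, x ∈ V := by
    intro j hj x hx
    obtain ⟨c, rfl⟩ := hspan j x hx
    refine Submodule.mem_iSup_of_mem (⟨j, by omega⟩ : Fin (D + 1)) ?_
    exact sum_mem fun i _ => Submodule.smul_mem _ (c i) (Submodule.subset_span ⟨i, rfl⟩)
  let W : Submodule K (ι → B) := S.restrictScalars K ⊓ Submodule.pi Set.univ fun _ => V
  have hW : W.FG := Submodule.FG.of_le (Submodule.fg_pi fun _ => hV) inf_le_right
  obtain ⟨T, hT⟩ := hW
  refine ⟨T, le_antisymm ?_ ?_⟩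
  · rw [Submodule.span_le]
    intro x hx
    have : x ∈ W := hT ▸ Submodule.subset_span hx
    exact this.1
  · rw [hS, Submodule.span_le]
    rintro c ⟨hc, hc'⟩
    have : c ∈ W := ⟨hc, fun t _ => by
      obtain ⟨j, hj, hj'⟩ := hc' t
      exact hmem j hj _ hj'⟩
    rw [← hT] at this
    exact Submodule.span_le_restrictScalars K B _ this

include hρ hfin hgen hrel in
-- The generators `t` are replaced by the products `w_j t`, where the `w_j` span `B_{N - n t}`, so
-- that all have degree `N`. In high degrees a relation between the `t` is one between these
-- products, because `B` is generated in degree one, and so it descends to lower degree. The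
-- relation module is therefore generated in bounded degrees.
theorem isLeftGradedCoherent_of_relations : IsLeftGradedCoherent 𝓑 := by
  classical
  intro I hI hfg
  obtain ⟨T, hT, rfl⟩ := exists_homogeneous_ideal_generators 𝓑 hI hfg
  choose n hn using hT
  -- A common upper bound for the degrees of the generators; the summand `1` is there because `hrel`
  -- concerns positive degrees only.
  let N : ℕ := 1 + ∑ t, n t
  have hnN : ∀ t, n t ≤ N := fun t =>
    (Finset.single_le_sum (f := n) (fun _ _ => Nat.zero_le _) (Finset.mem_univ t)).trans
      (Nat.le_add_left _ _)
  let ψ : (T → B) →ₗ[B] B := Fintype.linearCombination B fun t : T => (t : B)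
  have hψ : ∀ c, ψ c = ∑ t, c t * (t : B) := fun c => rfl
  have hrange : LinearMap.range ψ = Ideal.span (T : Set B) := by
    rw [Fintype.range_linearCombination]
    exact congrArg _ Subtype.range_coe
  suffices h : (LinearMap.ker ψ).FG by
    rw [← hrange]
    refine Module.finitePresentation_of_surjective ψ.rangeRestrict ψ.surjective_rangeRestrict ?_
    rwa [LinearMap.ker_rangeRestrict]
  choose r w hw hspan using hfin
  let κ : Type u := Σ t : T, ULift.{u} (Fin (r (N - n t)))
  let u : κ → B := fun p => w _ p.2.down * (p.1 : B)
  have hu : ∀ p, u p ∈ 𝓑 N := fun p => by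
    have := SetLike.mul_mem_graded (hw (N - n p.1) p.2.down) (hn p.1)
    rwa [Nat.sub_add_cancel (hnN _)] at this
  obtain ⟨d, hd⟩ := hrel N (Nat.le_add_right _ _) u hu
  refine fg_of_bounded_degree ρ (fun n => ⟨r n, w n, hw n, hspan n⟩) _ (d + N)
    (le_antisymm ?_ (Submodule.span_le.2 fun c hc => hc.1))
  set G := Submodule.span B {c | c ∈ LinearMap.ker ψ ∧ ∀ t, ∃ j ≤ d + N, c t ∈ 𝓑 j} with hG
  have high : ∀ i, ∀ c ∈ LinearMap.ker ψ, (∀ t, c t ∈ 𝓑 (i + (N - n t))) → c ∈ G := by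
    intro i
    induction i with
    | zero =>
      intro c hc hct
      exact Submodule.subset_span ⟨hc, fun t => ⟨_, by omega, hct t⟩⟩
    | succ i ih =>
      intro c hc hct
      by_cases hi : i + 1 ≤ d
      · exact Submodule.subset_span ⟨hc, fun t => ⟨_, by omega, hct t⟩⟩
      -- Split `c t` into factors of degrees `i + 1` and `N - n t`, expand the second ones in the
      -- `w_j`, and move the scalars to the left factors.
      · have hβ : ∀ t, ∃ β : Fin (r (N - n t)) → B, (∀ j, β j ∈ 𝓑 (i + 1)) ∧
            c t = ∑ j, β j * w _ j := by
          intro t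
          obtain ⟨s, z, y, hz, hy, h⟩ := exists_eq_sum_mul_of_mem hgen _ _ _ (hct t)
          choose a ha using fun l => hspan _ (y l) (hy l)
          refine ⟨fun j => ∑ l, z l * ρ (a l j), fun j => sum_mem fun l _ => ?_, ?_⟩
          · simpa using SetLike.mul_mem_graded (hz l) (hρ (a l j))
          · rw [h]
            simp only [Finset.sum_mul]
            rw [Finset.sum_comm]
            refine Finset.sum_congr rfl fun l _ => ?_
            conv_lhs => rw [ha l, Finset.mul_sum]
            exact Finset.sum_congr rfl fun j _ => (mul_assoc _ _ _).symm
        choose β hβ hc' using hβ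
        have sum_κ : ∀ f : κ → B, ∑ p, f p = ∑ t, ∑ j, f ⟨t, ⟨j⟩⟩ := by
          intro f
          rw [Fintype.sum_sigma]
          exact Finset.sum_congr rfl fun t _ =>
            (Equiv.ulift.symm.sum_comp fun j => f ⟨t, j⟩).symm
        have hψu : ∀ b : κ → B, ψ (fun t => ∑ j, b ⟨t, ⟨j⟩⟩ * w _ j) = ∑ p, b p * u p := by
          intro b
          rw [hψ, sum_κ]
          refine Finset.sum_congr rfl fun t _ => ?_
          rw [Finset.sum_mul]
          exact Finset.sum_congr rfl fun j _ => mul_assoc _ _ _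
        have hcβ : c = fun t => ∑ j, β t j * w _ j := funext hc'
        obtain ⟨s, ξ, b', hξ, hb', hb'u, hbb'⟩ := hd i (by omega) (fun p => β p.1 p.2.down)
          (fun p => hβ _ _) (by
            rw [← hψu, ← hcβ]
            exact LinearMap.mem_ker.1 hc)
        have hsum : c = ∑ l, ξ l • (fun t => ∑ j, b' l ⟨t, ⟨j⟩⟩ * w (N - n t) j : T → B) := by
          ext t
          rw [hc' t, Finset.sum_apply]
          simp only [Pi.smul_apply, smul_eq_mul, Finset.mul_sum]
          rw [Finset.sum_comm]
          refine Finset.sum_congr rfl fun j _ => ?_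
          rw [hbb' ⟨t, ⟨j⟩⟩, Finset.sum_mul]
          exact Finset.sum_congr rfl fun l _ => mul_assoc _ _ _
        rw [hsum]
        refine sum_mem fun l _ => Submodule.smul_mem _ _ (ih _ ?_ fun t => ?_)
        · rw [LinearMap.mem_ker, hψu, hb'u]
        · exact sum_mem fun j _ => SetLike.mul_mem_graded (hb' l _) (hw _ j)
  intro c hc
  -- With the generators placed in degrees `n t`, `ψ` becomes a map of graded modules. Its kernel is
  -- homogeneous, and it suffices to treat homogeneous relations.
  let F := GrMod.free 𝓑 T fun t => (n t : ℤ)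
  let f : F ⟶ GrMod.free 𝓑 PUnit fun _ => 0 :=
    GrMod.freeDesc (fun t => Finsupp.single PUnit.unit (t : B)) fun t =>
      GrMod.mem_free_deg.2 fun s => by
        rw [Finsupp.single_eq_same, sub_zero, mem_homogDeg_natCast]
        exact hn t
  let ev : F.carrier ≃ₗ[B] (T → B) := Finsupp.linearEquivFunOnFinite B B T
  have hf : ∀ x : F.carrier, f.1 x = Finsupp.single PUnit.unit (ψ (ev x)) := by
    have : Finsupp.linearCombination B (fun t : T => Finsupp.single PUnit.unit (t : B)) =
        Finsupp.lsingle PUnit.unit ∘ₗ ψ ∘ₗ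
          (Finsupp.linearEquivFunOnFinite B B T).toLinearMap := by
      refine Finsupp.lhom_ext' fun t => LinearMap.ext_ring ?_
      simp [ψ, Fintype.linearCombination_apply, Pi.single_apply]
    exact LinearMap.congr_fun this
  have hker : ∀ x : F.carrier, x ∈ LinearMap.ker f.1 ↔ ev x ∈ LinearMap.ker ψ := by
    intro x
    rw [LinearMap.mem_ker, hf, LinearMap.mem_ker]
    exact Finsupp.single_eq_zero
  obtain ⟨x, rfl⟩ := ev.surjective c
  obtain ⟨s, hs⟩ := F.exists_eq_sum_proj x
  rw [hs, map_sum]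
  refine sum_mem fun j _ => ?_
  have h1 : ev (F.proj j x) ∈ LinearMap.ker ψ :=
    (hker _).1 (GrMod.isHomog_ker f x ((hker x).2 hc) j)
  have h2 : ∀ t, ev (F.proj j x) t ∈ homogDeg 𝓑 (j - n t) :=
    GrMod.mem_free_deg.1 (F.proj_mem j x)
  rcases le_or_gt (N : ℤ) j with hj | hj
  -- In total degree at least `N`, descent applies; below `N`, the coefficients already satisfy the
  -- degree bound.
  · obtain ⟨i, hi⟩ := Int.eq_ofNat_of_zero_le (sub_nonneg.2 hj)
    refine high i _ h1 fun t => ?_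
    have h3 := h2 t
    have := hnN t
    rw [show j - n t = ((i + (N - n t) : ℕ) : ℤ) by omega, mem_homogDeg_natCast] at h3
    exact h3
  · refine Submodule.subset_span ⟨h1, fun t => ?_⟩
    rcases h2 t with h | ⟨k, hk, h⟩
    · exact ⟨0, Nat.zero_le _, by rw [h]; exact zero_mem _⟩
    · exact ⟨k, by omega, h⟩

end CoherenceCriterion


/-! ## Relations in the Yoneda algebra of the residue module -/

section ResidueExt

variable {K : Type v} {A : Type u} [Field K] [Ring A] [Algebra K A]
  {𝒜 : ℕ → Submodule K A} [GradedAlgebra 𝒜]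

/-- The hypotheses describe `N` as the fibre product of `W` and `A^κ` over `(A/𝔪)^κ`, with `ker c ≅
𝔪^κ`. The connecting map sends `(b₁ k)`, a lift of `(b k)` to `Ext(𝔪, A/𝔪)`, to `∑ φ_k b_k`. A
relation therefore extends to a class `γ` on `N`. Writing `γ` as a sum of products with `Ext^1` and
restricting the factors back to `𝔪^κ` gives the smaller relations. -/
lemma exists_reduced_relations {N W : Type u} [AddCommGroup N] [Module A N] [AddCommGroup W]
    [Module A W] {κ : Type*} [Fintype κ] [DecidableEq κ] {c : N →ₗ[A] W}
    (hc : Function.Surjective c) (pr : κ → (N →ₗ[A] A)) (φ : κ → (W →ₗ[A] ResidueModule 𝒜))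
    (hφ : ∀ k x, φ k (c x) = (irrel 𝒜).mkQ (pr k x)) (inc : κ → (irrel 𝒜 →ₗ[A] N))
    (hcinc : ∀ k y, c (inc k y) = 0)
    (hprinc : ∀ j k y, pr j (inc k y) = if j = k then (y : A) else 0)
    (hker : ∀ x, c x = 0 → ∀ y : κ → irrel 𝒜, (∀ k, (y k : A) = pr k x) → ∑ k, inc k (y k) = x)
    {i : ℕ} (hN : ExtGenerated 𝒜 (ModuleCat.of A N) i)
    (b : κ → Ext (residue 𝒜) (residue 𝒜) (i + 1 + 1))
    (hb : ∑ k, (Ext.mk₀ (ModuleCat.ofHom (φ k))).comp (b k) (zero_add _) = 0) :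
    ∃ (r : ℕ) (ξ : Fin r → Ext (residue 𝒜) (residue 𝒜) 1)
      (b' : Fin r → κ → Ext (residue 𝒜) (residue 𝒜) (i + 1)),
      (∀ l, ∑ k, (Ext.mk₀ (ModuleCat.ofHom (φ k))).comp (b' l k) (zero_add _) = 0) ∧
      ∀ k, b k = ∑ l, (b' l k).comp (ξ l) rfl := by
  set Z := LinearMap.ker c with hZ
  have hpr : ∀ k, ∀ x ∈ Z, pr k x ∈ irrel 𝒜 := by
    intro k x hx
    have := hφ k x
    rw [LinearMap.mem_ker.1 hx, map_zero] at this
    exact (Submodule.Quotient.mk_eq_zero _).1 this.symm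
  have hS := kerComplex_shortExact hZ.symm hc
  let p : ∀ k, ModuleCat.of A Z ⟶ ModuleCat.of A (irrel 𝒜) :=
    fun k => ModuleCat.ofHom ((pr k).restrict (hpr k))
  let ι : ∀ k, ModuleCat.of A (irrel 𝒜) ⟶ ModuleCat.of A Z :=
    fun k => ModuleCat.ofHom ((inc k).codRestrict Z fun y => LinearMap.mem_ker.2 (hcinc k y))
  have hιp : ∀ j k, ι k ≫ p j = if j = k then 𝟙 _ else 0 := by
    intro j k
    ext y
    refine (hprinc j k y).trans ?_
    split_ifs <;> rfl
  have hpι : ∑ k, p k ≫ ι k = 𝟙 _ := by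
    ext x
    rw [ModuleCat.hom_sum, LinearMap.sum_apply, Submodule.coe_sum]
    exact hker x (LinearMap.mem_ker.1 x.2) (fun k => ⟨pr k x, hpr k x x.2⟩) fun k => rfl
  -- The `k`-th component of the extension by `𝔪^κ` is the pullback of the residue extension along
  -- `φ k`.
  have hη : ∀ k, hS.extClass.comp (Ext.mk₀ (p k)) (add_zero 1) =
      (Ext.mk₀ (ModuleCat.ofHom (φ k))).comp (residueClass 𝒜) (zero_add 1) := by
    intro k
    obtain ⟨q, hq, h⟩ := exists_extClass_comp_mk₀_eq hZ.symm (irrel 𝒜).ker_mkQ hc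
      (irrel 𝒜).mkQ_surjective (pr k) (hpr k)
    obtain rfl : q = φ k := by
      ext y
      obtain ⟨x, rfl⟩ := hc y
      rw [hq, hφ]
    exact h
  choose b₁ hb₁ using fun k => exists_extClass_comp_eq (irrel 𝒜).ker_mkQ (irrel 𝒜).mkQ_surjective
    (b k)
  let β := ∑ k, (Ext.mk₀ (p k)).comp (b₁ k) (zero_add _)
  have hβ : hS.extClass.comp β (add_comm 1 _) = 0 := by
    rw [Ext.comp_sum, ← hb]
    refine Finset.sum_congr rfl fun k _ => ?_
    rw [← Ext.comp_assoc (a₁₂ := 1) _ _ _ (by omega) (by omega) (by omega), hη, ← hb₁ k]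
    exact Ext.comp_assoc _ _ _ _ _ (by omega)
  obtain ⟨γ, hγ⟩ := Ext.contravariant_sequence_exact₁ hS _ β _ hβ
  obtain ⟨r, g, ξ, hg⟩ := hN γ
  refine ⟨r, ξ, fun l k => (residueClass 𝒜).comp ((Ext.mk₀ (ι k)).comp
    ((Ext.mk₀ (kerComplex Z c hZ.symm).f).comp (g l) (zero_add i)) (zero_add i)) (add_comm 1 i),
    ?_, ?_⟩
  · intro l
    have h1 : ∀ k, (Ext.mk₀ (ModuleCat.ofHom (φ k))).comp ((residueClass 𝒜).comp
        ((Ext.mk₀ (ι k)).comp ((Ext.mk₀ (kerComplex Z c hZ.symm).f).comp (g l) (zero_add i))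
        (zero_add i)) (add_comm 1 i)) (zero_add _) = hS.extClass.comp ((Ext.mk₀ (p k ≫ ι k)).comp
        ((Ext.mk₀ (kerComplex Z c hZ.symm).f).comp (g l) (zero_add i)) (zero_add i))
        (add_comm 1 i) := by
      intro k
      rw [← Ext.comp_assoc (a₁₂ := 1) _ _ _ (by omega) (by omega) (by omega), ← hη,
        Ext.comp_assoc (a₂₃ := i) _ _ _ (by omega) (by omega) (by omega), Ext.mk₀_comp_mk₀_assoc]
    rw [Finset.sum_congr rfl fun k _ => h1 k, ← Ext.comp_sum, ← Ext.sum_comp, ← Ext.mk₀_sum, hpι,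
      Ext.mk₀_id_comp]
    -- Consecutive maps of the long exact sequence compose to zero, so whatever is restricted from
    -- `N` yields a relation.
    exact hS.extClass_comp_assoc _
  · intro k
    have h2 : ∀ l, ((residueClass 𝒜).comp ((Ext.mk₀ (ι k)).comp
        ((Ext.mk₀ (kerComplex Z c hZ.symm).f).comp (g l) (zero_add i)) (zero_add i))
        (add_comm 1 i)).comp (ξ l) rfl = (residueClass 𝒜).comp ((Ext.mk₀ (ι k)).comp
        ((Ext.mk₀ (kerComplex Z c hZ.symm).f).comp ((g l).comp (ξ l) rfl) (zero_add (i + 1)))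
        (zero_add (i + 1))) (add_comm 1 (i + 1)) := by
      intro l
      rw [Ext.comp_assoc (a₂₃ := i + 1) _ _ _ (by omega) (by omega) (by omega),
        Ext.comp_assoc (a₂₃ := i + 1) _ _ _ (by omega) (by omega) (by omega),
        Ext.comp_assoc (a₂₃ := i + 1) _ _ _ (by omega) (by omega) (by omega)]
    rw [Finset.sum_congr rfl fun l _ => h2 l, ← Ext.comp_sum, ← Ext.comp_sum, ← Ext.comp_sum, ← hg,
      hγ, ← hb₁ k, Ext.comp_sum]
    have h3 : ∀ j, (Ext.mk₀ (ι k)).comp ((Ext.mk₀ (p j)).comp (b₁ j) (zero_add _)) (zero_add _) =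
        if j = k then b₁ k else 0 := by
      intro j
      rw [Ext.mk₀_comp_mk₀_assoc, hιp]
      split_ifs with h
      · rw [h, Ext.mk₀_id_comp]
      · rw [Ext.mk₀_zero, Ext.zero_comp]
    rw [Finset.sum_congr rfl fun j _ => h3 j, Finset.sum_ite_eq' Finset.univ k,
      if_pos (Finset.mem_univ k)]
    rfl

/-! ### Finite dimensionality of `Ext` into the residue module. -/

variable (𝒜) in
/-- Multiplication by a scalar on the residue module. -/
def residueScalar (c : K) : residue 𝒜 ⟶ residue 𝒜 :=
  ModuleCat.ofHom (c • (LinearMap.id : ResidueModule 𝒜 →ₗ[A] ResidueModule 𝒜))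

lemma residueScalar_one : residueScalar 𝒜 1 = 𝟙 _ := by
  exact ModuleCat.hom_ext (LinearMap.ext fun x => one_smul K x)

lemma residueScalar_zero : residueScalar 𝒜 0 = 0 := by
  exact ModuleCat.hom_ext (LinearMap.ext fun x => zero_smul K x)

lemma residueScalar_add (c d : K) :
    residueScalar 𝒜 (c + d) = residueScalar 𝒜 c + residueScalar 𝒜 d := by
  exact ModuleCat.hom_ext (LinearMap.ext fun x => add_smul c d x)

lemma residueScalar_mul (c d : K) :
    residueScalar 𝒜 (c * d) = residueScalar 𝒜 d ≫ residueScalar 𝒜 c := by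
  exact ModuleCat.hom_ext (LinearMap.ext fun x => mul_smul c d x)

lemma finite_residue (h_zero : Function.Bijective (algebraMap K (𝒜 0))) :
    Module.Finite K (ResidueModule 𝒜) := by
  refine Module.Finite.of_surjective
    (LinearMap.toSpanSingleton K (ResidueModule 𝒜) ((irrel 𝒜).mkQ 1)) fun y => ?_
  obtain ⟨c, rfl⟩ := exists_residue_eq h_zero y
  refine ⟨c, ?_⟩
  rw [LinearMap.toSpanSingleton_apply, Algebra.algebraMap_eq_smul_one]
  rfl

lemma exists_ext_zero_generators (Y : ModuleCat.{u} A)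
    (hfin : Module.Finite K (Y →ₗ[A] ResidueModule 𝒜)) :
    ∃ (r : ℕ) (w : Fin r → Ext Y (residue 𝒜) 0), ∀ x, ∃ c : Fin r → K,
      x = ∑ j, (w j).comp (Ext.mk₀ (residueScalar 𝒜 (c j))) (add_zero 0) := by
  obtain ⟨r, w, hw⟩ := Submodule.fg_iff_exists_fin_generating_family.1 hfin.fg_top
  refine ⟨r, fun j => Ext.mk₀ (ModuleCat.ofHom (w j)), fun x => ?_⟩
  obtain ⟨f, rfl⟩ := (Ext.mk₀_bijective _ _).2 x
  have hf : f.hom ∈ Submodule.span K (Set.range w) := hw ▸ Submodule.mem_top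
  obtain ⟨c, hc⟩ := (Submodule.mem_span_range_iff_exists_fun K).1 hf
  refine ⟨c, ?_⟩
  simp only [Ext.mk₀_comp_mk₀]
  rw [← Ext.mk₀_sum]
  congr 1
  ext x
  rw [← hc, ModuleCat.hom_sum, LinearMap.sum_apply, LinearMap.sum_apply]
  rfl

/-- In degree zero a map is determined by its values on finitely many generators, in a
finite-dimensional space. Higher degrees follow by shifting to the next syzygy. -/
lemma GradedFreeResolution.exists_ext_generators
    (h_zero : Function.Bijective (algebraMap K (𝒜 0))) {M : GrMod 𝒜}
    (P : GradedFreeResolution M) [∀ i, Finite (P.ι i)] (n : ℕ) :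
    ∀ i, ∃ (r : ℕ) (w : Fin r → Ext (P.syz i) (residue 𝒜) n), ∀ x, ∃ c : Fin r → K,
      x = ∑ j, (w j).comp (Ext.mk₀ (residueScalar 𝒜 (c j))) (add_zero n) := by
  induction n with
  | zero =>
    intro i
    have := finite_residue h_zero
    let ev : (P.syz i →ₗ[A] ResidueModule 𝒜) →ₗ[K] (P.ι i → ResidueModule 𝒜) :=
      { toFun := fun f s => f (P.cover i (Finsupp.single s 1))
        map_add' := fun _ _ => rfl
        map_smul' := fun _ _ => rfl }
    have hev : Function.Injective ev := by
      intro f g hfg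
      have h : f ∘ₗ P.cover i = g ∘ₗ P.cover i :=
        Finsupp.lhom_ext' fun s => LinearMap.ext_ring (congrFun hfg s)
      ext y
      obtain ⟨x, rfl⟩ := P.cover_surjective i y
      exact LinearMap.congr_fun h x
    have hfin : Module.Finite K (P.syz i →ₗ[A] ResidueModule 𝒜) :=
      Module.Finite.of_injective ev hev
    exact exists_ext_zero_generators (P.syz i) hfin
  | succ n ih =>
    intro i
    obtain ⟨r, w, hw⟩ := ih (i + 1)
    refine ⟨r, fun j => (P.syzClass i).comp (w j) (add_comm 1 n), fun x => ?_⟩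
    obtain ⟨y, rfl⟩ := exists_syzClass_comp_eq x
    obtain ⟨c, hc⟩ := hw y
    refine ⟨c, ?_⟩
    conv_lhs => rw [hc, Ext.comp_sum]
    exact Finset.sum_congr rfl fun j _ => (Ext.comp_assoc _ _ _ _ _ (by omega)).symm

end ResidueExt


/-! ## Coherence of the Koszul dual -/

section KoszulDualCoherent

lemma of_comp {A : Type u} [Ring A] {X : ModuleCat.{u} A} {a b c : ℕ} (f : Ext X X a)
    (g : Ext X X b) (h : a + b = c) :
    DirectSum.of (SelfExt X) c (f.comp g h) =
      DirectSum.of (SelfExt X) b g * DirectSum.of (SelfExt X) a f := by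
  obtain rfl : c = b + a := by omega
  exact (DirectSum.of_mul_of (A := SelfExt X) (i := b) (j := a) g f).symm

variable {K : Type v} {A : Type u} [Field K] [Ring A] [Algebra K A]
  {𝒜 : ℕ → Submodule K A} [GradedAlgebra 𝒜]

/-- An infimum below `⊤` is attained below `⊤` by some member, so the hypothesis also supplies the
minimal resolution. -/
lemma exists_isMinimal_of_linearityDefect_lt_top {M : GrMod 𝒜} (h : linearityDefect M < ⊤) :
    ∃ P : GradedFreeResolution M, P.IsMinimal ∧ ∃ d, ∀ i, d ≤ i → ¬ P.LinHomologyNeZero i := by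
  obtain ⟨P, hP⟩ := iInf_lt_iff.1 h
  obtain ⟨hmin, hlt⟩ := iInf_lt_iff.1 hP
  refine ⟨P, hmin, ?_⟩
  by_contra! hcon
  refine hlt.ne (eq_top_iff.2 ?_)
  have hle : ∀ d : ℕ, ((d : ℕ∞) : WithBot ℕ∞) ≤ P.linDefect := by
    intro d
    obtain ⟨i, hi, hne⟩ := hcon d
    exact (WithBot.coe_le_coe.2 (Nat.cast_le.2 hi)).trans
      (le_iSup₂_of_le (f := fun i (_ : P.LinHomologyNeZero i) => ((i : ℕ∞) : WithBot ℕ∞))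
        i hne le_rfl)
  cases hx : P.linDefect with
  | bot => exact absurd (hle 0) (by rw [hx]; simp)
  | coe x =>
    rw [hx] at hle
    rw [ENat.eq_top_iff_forall_ge.2 fun d => WithBot.coe_le_coe.1 (hle d)]
    rfl

namespace GradedFreeResolution

variable {M : GrMod 𝒜} {P : GradedFreeResolution M}

lemma d_single_mem_one (hdeg : ∀ (i : ℕ) (s : P.ι i), P.deg i s = i) (i : ℕ)
    (s : P.ι (i + 1)) (t : P.ι i) : P.d i (Finsupp.single s 1) t ∈ 𝒜 1 := by
  have h := P.d_homogeneous i s t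
  rw [hdeg, hdeg] at h
  rw [← mem_homogDeg_natCast (𝓡 := 𝒜), mem_homogDeg]
  convert h using 1
  push_cast
  ring

lemma isMinimal_of_linear (hdeg : ∀ (i : ℕ) (s : P.ι i), P.deg i s = i) : P.IsMinimal :=
  fun i s t => mem_irrel_of_mem one_pos (d_single_mem_one hdeg i s t)

lemma lin_eq_d (hdeg : ∀ (i : ℕ) (s : P.ι i), P.deg i s = i) (i : ℕ) : P.lin i = P.d i := by
  refine Finsupp.lhom_ext' fun s => LinearMap.ext_ring ?_
  change P.lin i (Finsupp.single s 1) = P.d i (Finsupp.single s 1)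
  rw [lin_single, Finsupp.filter_eq_self_iff]
  intro t _
  rw [hdeg, hdeg]
  push_cast
  omega

/-- A linear resolution equals its linear part, hence is exact in positive degrees. -/
lemma not_linHomologyNeZero (hdeg : ∀ (i : ℕ) (s : P.ι i), P.deg i s = i) (i : ℕ) :
    ¬ P.LinHomologyNeZero (i + 1) := by
  refine not_not.2 ?_
  rw [lin_eq_d hdeg, lin_eq_d hdeg, (P.exact_d i).linearMap_ker_eq]

end GradedFreeResolution

/-! ### The fibre product over powers of the residue module. -/

variable (P : GradedFreeResolution (residueGrMod 𝒜)) (hdeg : ∀ (i : ℕ) (s : P.ι i), P.deg i s = i)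
  (h_zero : Function.Bijective (algebraMap K (𝒜 0)))

include h_zero in
lemma nonempty_generators : Nonempty (P.ι 0) := by
  by_contra hne
  rw [not_nonempty_iff] at hne
  obtain ⟨z, hz⟩ := P.aug_surjective ((irrel 𝒜).mkQ 1)
  rw [Subsingleton.elim z 0, map_zero] at hz
  have h1 : algebraMap K A 1 ∈ irrel 𝒜 := by
    rw [map_one]
    exact (Submodule.Quotient.mk_eq_zero _).1 hz.symm
  exact one_ne_zero (eq_zero_of_algebraMap_mem h_zero h1)

include h_zero in
/-- The ideal `𝔪` is generated by the entries of the first differential in a row. -/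
lemma irrel_le_span (s : P.ι 0) :
    irrel 𝒜 ≤ Submodule.span A (Set.range fun t => P.d 0 (Finsupp.single t 1) s) := by
  intro x hx
  have haug : P.aug (Finsupp.single s x) = 0 := by
    obtain ⟨c, hc⟩ := exists_residue_eq h_zero (P.aug (Finsupp.single s 1))
    rw [← mul_one x, ← smul_eq_mul, ← Finsupp.smul_single, map_smul, hc]
    exact (Submodule.Quotient.mk_eq_zero _).2 (mul_mem_irrel_right hx)
  obtain ⟨z, hz⟩ := (P.exact_aug _).1 haug
  have hx' : x = P.d 0 z s := by rw [hz, Finsupp.single_eq_same]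
  rw [hx']
  clear hz hx' haug hx x
  induction z using Finsupp.induction_linear with
  | zero => simp
  | add y z hy hz => rw [map_add, Finsupp.add_apply]; exact add_mem hy hz
  | single t a =>
    rw [← mul_one a, ← smul_eq_mul, ← Finsupp.smul_single, map_smul, Finsupp.smul_apply]
    exact Submodule.smul_mem _ _ (Submodule.subset_span ⟨t, rfl⟩)

variable [∀ i, Finite (P.ι i)]

include hdeg h_zero in
/-- For maps from a syzygy of the residue module to the residue module, the fibre product with
copies of `A` is a finitely generated graded module. -/
lemma exists_fibreProduct (n : ℕ) {κ : Type u} [Fintype κ] [DecidableEq κ]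
    (φ : κ → (LinearMap.range (P.d n) →ₗ[A] ResidueModule 𝒜)) :
    ∃ (N : GrMod 𝒜) (c : N.carrier →ₗ[A] LinearMap.range (P.d n)) (pr : κ → (N.carrier →ₗ[A] A))
      (inc : κ → (irrel 𝒜 →ₗ[A] N.carrier)), Module.Finite A N.carrier ∧
      Function.Surjective c ∧ (∀ k x, φ k (c x) = (irrel 𝒜).mkQ (pr k x)) ∧
      (∀ k y, c (inc k y) = 0) ∧ (∀ j k y, pr j (inc k y) = if j = k then (y : A) else 0) ∧
      ∀ x, c x = 0 → ∀ y : κ → irrel 𝒜, (∀ k, (y k : A) = pr k x) → ∑ k, inc k (y k) = x := by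
  classical
  obtain ⟨s₀⟩ := nonempty_generators P h_zero
  -- By linearity the syzygy is generated in degree `n + 1` alone. Placing the copies of `A` in the
  -- same degree makes its lifted generators homogeneous.
  let F : GrMod 𝒜 := (GrMod.free 𝒜 (P.ι n) (P.deg n)).prod (GrMod.free 𝒜 κ fun _ => (n + 1 : ℤ))
  let F' : Type u := (P.ι n →₀ A) × (κ →₀ A)
  choose a ha using fun k t => exists_residue_eq h_zero
    (φ k ⟨P.d n (Finsupp.single t 1), LinearMap.mem_range_self _ _⟩)
  let g : P.ι (n + 1) → F' := fun t =>
    (P.d n (Finsupp.single t 1), Finsupp.equivFunOnFinite.symm fun k => algebraMap K A (a k t))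
  -- Generators of `𝔪^κ`, of degree `n + 2`: the entries in row `s₀` of the first differential have
  -- degree one and generate `𝔪`.
  let h : P.ι (0 + 1) × κ → F' := fun p =>
    (0, Finsupp.single p.2 (P.d 0 (Finsupp.single p.1 1) s₀))
  let N : Submodule A F' := Submodule.span A (Set.range g ∪ Set.range h)
  have hhom : F.IsHomog N := by
    refine GrMod.isHomog_span ?_
    rintro _ (⟨t, rfl⟩ | ⟨p, rfl⟩)
    · refine ⟨n + 1, GrMod.mem_free_deg.2 fun s => ?_, GrMod.mem_free_deg.2 fun k => ?_⟩
      · have := P.d_homogeneous n t s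
        rw [hdeg (n + 1)] at this
        exact_mod_cast this
      · refine Or.inr ⟨0, by simp, ?_⟩
        exact SetLike.algebraMap_mem_graded 𝒜 _
    · refine ⟨n + 2, zero_mem _, GrMod.mem_free_deg.2 fun k => ?_⟩
      change Finsupp.single p.2 _ k ∈ _
      rw [Finsupp.single_apply]
      split_ifs
      · refine Or.inr ⟨1, by push_cast; ring, ?_⟩
        exact GradedFreeResolution.d_single_mem_one hdeg 0 p.1 s₀
      · exact zero_mem _
  have key : ∀ x ∈ N, ∃ hx : x.1 ∈ LinearMap.range (P.d n),
      ∀ k, φ k ⟨x.1, hx⟩ = (irrel 𝒜).mkQ (x.2 k) := by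
    intro x hx
    induction hx using Submodule.span_induction with
    | mem x hx =>
      rcases hx with ⟨t, rfl⟩ | ⟨p, rfl⟩
      · exact ⟨⟨_, rfl⟩, fun k => ha k t⟩
      · refine ⟨zero_mem _, fun k => ?_⟩
        refine (map_zero (φ k)).trans ?_
        refine ((Submodule.Quotient.mk_eq_zero _).2 ?_).symm
        change Finsupp.single p.2 _ k ∈ _
        rw [Finsupp.single_apply]
        split_ifs
        · exact GradedFreeResolution.isMinimal_of_linear hdeg 0 p.1 s₀
        · exact zero_mem _
    | zero => exact ⟨zero_mem _, fun k => by
        refine (map_zero (φ k)).trans (map_zero _).symm⟩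
    | add x y _ _ hx hy =>
      obtain ⟨hx, hx'⟩ := hx
      obtain ⟨hy, hy'⟩ := hy
      refine ⟨add_mem hx hy, fun k => ?_⟩
      refine (map_add (φ k) ⟨x.1, hx⟩ ⟨y.1, hy⟩).trans ?_
      rw [hx', hy', ← map_add]
      rfl
    | smul r x _ hx =>
      obtain ⟨hx, hx'⟩ := hx
      refine ⟨Submodule.smul_mem _ _ hx, fun k => ?_⟩
      refine (map_smul (φ k) r ⟨x.1, hx⟩).trans ?_
      rw [hx', ← map_smul]
      rfl
  have hinc : ∀ k, ∀ y ∈ irrel 𝒜, ((0, Finsupp.single k y) : F') ∈ N := by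
    intro k y hy
    let i : A →ₗ[A] F' := LinearMap.inr A _ _ ∘ₗ Finsupp.lsingle k
    have : irrel 𝒜 ≤ N.comap i := (irrel_le_span P h_zero s₀).trans (Submodule.span_le.2 (by
      rintro _ ⟨t, rfl⟩
      exact Submodule.subset_span (Or.inr ⟨(t, k), rfl⟩)))
    exact this hy
  let c : N →ₗ[A] LinearMap.range (P.d n) :=
    (LinearMap.fst A _ _ ∘ₗ N.subtype).codRestrict _ fun x => (key x x.2).1
  have hN : Module.Finite A N :=
    Module.Finite.of_fg (Submodule.fg_span ((Set.finite_range g).union (Set.finite_range h)))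
  have hsum : ∀ x : N, x.1.1 = 0 → ∀ y : κ → irrel 𝒜, (∀ k, (y k : A) = x.1.2 k) →
      ∑ k, (⟨(0, Finsupp.single k (y k : A)), hinc k _ (y k).2⟩ : N) = x := by
    intro x hx y hy
    apply Subtype.ext
    rw [Submodule.coe_sum]
    refine Prod.ext ?_ ?_
    · rw [hx, Prod.fst_sum]
      exact Finset.sum_eq_zero fun k _ => rfl
    · rw [Prod.snd_sum]
      refine (Finset.sum_congr rfl fun k _ => ?_).trans (Finsupp.univ_sum_single x.1.2)
      exact congrArg (Finsupp.single k) (hy k)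
  refine ⟨F.ofSub N hhom, c, fun k => Finsupp.lapply k ∘ₗ LinearMap.snd A _ _ ∘ₗ N.subtype,
    fun k => (LinearMap.inr A _ _ ∘ₗ Finsupp.lsingle k ∘ₗ (irrel 𝒜).subtype).codRestrict N
      fun y => hinc k y y.2, ?_, ?_, ?_, ?_, ?_, ?_⟩
  · exact hN
  · rintro ⟨_, z, rfl⟩
    have : ∃ x ∈ N, x.1 = P.d n z := by
      induction z using Finsupp.induction_linear with
      | zero => exact ⟨0, zero_mem _, (map_zero _).symm⟩
      | add y z hy hz =>
        obtain ⟨x, hx, hx'⟩ := hy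
        obtain ⟨w, hw, hw'⟩ := hz
        exact ⟨x + w, add_mem hx hw, by rw [map_add, ← hx', ← hw']; rfl⟩
      | single t r =>
        refine ⟨r • g t, Submodule.smul_mem _ _ (Submodule.subset_span (Or.inl ⟨t, rfl⟩)), ?_⟩
        rw [← mul_one r, ← smul_eq_mul, ← Finsupp.smul_single, map_smul, smul_eq_mul, mul_one]
        rfl
    obtain ⟨x, hx, hx'⟩ := this
    exact ⟨⟨x, hx⟩, Subtype.ext hx'⟩
  · exact fun k x => (key x.1 x.2).2 k
  · exact fun k y => rfl
  · intro j k y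
    change Finsupp.single k (y : A) j = _
    rw [Finsupp.single_apply]
    simp only [eq_comm]
  · intro x hx y hy
    exact hsum x (congrArg Subtype.val hx) y hy

/-! ### Relations in the Koszul dual. -/

variable (𝒜) in
/-- The scalars as elements of degree zero of the Koszul dual. -/
def scalarHom : K →+* KoszulDual 𝒜 where
  toFun c := DirectSum.of (SelfExt (residue 𝒜)) 0 (Ext.mk₀ (residueScalar 𝒜 c))
  map_one' := by rw [residueScalar_one]; rfl
  map_zero' := by
    rw [residueScalar_zero, Ext.mk₀_zero]
    exact map_zero (DirectSum.of (SelfExt (residue 𝒜)) 0)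
  map_add' c d := by
    rw [residueScalar_add, Ext.mk₀_add]
    exact map_add (DirectSum.of (SelfExt (residue 𝒜)) 0) _ _
  map_mul' c d := by
    rw [residueScalar_mul, ← Ext.mk₀_comp_mk₀, of_comp]

lemma of_sum {X : ModuleCat.{u} A} {n : ℕ} {ι : Type*} [Fintype ι] (f : ι → Ext X X n) :
    DirectSum.of (SelfExt X) n (∑ k, f k) = ∑ k, DirectSum.of (SelfExt X) n (f k) :=
  map_sum (DirectSum.of (SelfExt X) n) _ _

/-- The common factor `δ` of all `u_k` can be cancelled, so relations in the Yoneda algebra become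
relations in `Ext(W, X)`. -/
lemma sum_of_mul_eq_zero_iff {X W : ModuleCat.{u} A} {m i : ℕ} (δ : Ext X W m)
    (hδ : ∀ y : Ext W X (i + 1), δ.comp y rfl = 0 → y = 0) {κ : Type*} [Fintype κ]
    (ψ : κ → (W ⟶ X)) (b : κ → Ext X X (i + 1)) :
    ∑ k, DirectSum.of (SelfExt X) (i + 1) (b k) *
      DirectSum.of (SelfExt X) m (δ.comp (Ext.mk₀ (ψ k)) (add_zero m)) = 0 ↔
    ∑ k, (Ext.mk₀ (ψ k)).comp (b k) (zero_add _) = 0 := by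
  have h : ∀ k, DirectSum.of (SelfExt X) (i + 1) (b k) *
      DirectSum.of (SelfExt X) m (δ.comp (Ext.mk₀ (ψ k)) (add_zero m)) =
      DirectSum.of (SelfExt X) (m + (i + 1))
        (δ.comp ((Ext.mk₀ (ψ k)).comp (b k) (zero_add _)) rfl) := fun k => by
    rw [← Ext.comp_assoc_of_second_deg_zero]
    exact (of_comp _ _ _).symm
  have hsum : ∑ k, DirectSum.of (SelfExt X) (i + 1) (b k) *
      DirectSum.of (SelfExt X) m (δ.comp (Ext.mk₀ (ψ k)) (add_zero m)) =
      DirectSum.of (SelfExt X) (m + (i + 1))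
        (δ.comp (∑ k, (Ext.mk₀ (ψ k)).comp (b k) (zero_add _)) rfl) :=
    (Finset.sum_congr rfl fun k _ => h k).trans ((of_sum _).symm.trans
      (congrArg (DirectSum.of (SelfExt X) _) (Ext.comp_sum _ _ _).symm))
  rw [hsum]
  constructor
  · intro h
    exact hδ _ (DirectSum.of_injective (β := SelfExt X) _ (h.trans (map_zero _).symm))
  · intro h
    rw [h, Ext.comp_zero]
    exact map_zero (DirectSum.of (SelfExt X) _)

lemma relationsGenerated_yoneda {X W : ModuleCat.{u} A} {m : ℕ} (δ : Ext X W m)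
    (hδ : ∀ (i : ℕ) (y : Ext W X (i + 1)), δ.comp y rfl = 0 → y = 0) {κ : Type u} [Fintype κ]
    (ψ : κ → (W ⟶ X))
    (h : ∃ d : ℕ, ∀ i, d ≤ i → ∀ b : κ → Ext X X (i + 1 + 1),
      ∑ k, (Ext.mk₀ (ψ k)).comp (b k) (zero_add _) = 0 →
      ∃ (r : ℕ) (ξ : Fin r → Ext X X 1) (b' : Fin r → κ → Ext X X (i + 1)),
        (∀ l, ∑ k, (Ext.mk₀ (ψ k)).comp (b' l k) (zero_add _) = 0) ∧
        ∀ k, b k = ∑ l, (b' l k).comp (ξ l) rfl) :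
    RelationsGenerated (yonedaDeg X) fun k =>
      DirectSum.of (SelfExt X) m (δ.comp (Ext.mk₀ (ψ k)) (add_zero m)) := by
  obtain ⟨d, h⟩ := h
  -- The shift by one keeps the coefficients of the smaller relations in positive degree, where `δ`
  -- can be cancelled.
  refine ⟨d + 1, fun i hi b hb hbu => ?_⟩
  obtain ⟨i, rfl⟩ : ∃ m, i = m + 1 := ⟨i - 1, by omega⟩
  choose b₁ hb₁ using hb
  obtain rfl : (fun k => DirectSum.of (SelfExt X) (i + 1 + 1) (b₁ k)) = b := funext hb₁
  obtain ⟨r, ξ, b', hb', hbb'⟩ :=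
    h i (by omega) b₁ ((sum_of_mul_eq_zero_iff δ (hδ (i + 1)) ψ b₁).1 hbu)
  refine ⟨r, fun l => DirectSum.of (SelfExt X) 1 (ξ l),
    fun l k => DirectSum.of (SelfExt X) (i + 1) (b' l k), fun l => ⟨_, rfl⟩,
    fun l k => ⟨_, rfl⟩, fun l => (sum_of_mul_eq_zero_iff δ (hδ i) ψ (b' l)).2 (hb' l),
    fun k => ?_⟩
  refine (congrArg (DirectSum.of (SelfExt X) (i + 1 + 1)) (hbb' k)).trans ((of_sum _).trans ?_)
  exact Finset.sum_congr rfl fun j _ => of_comp _ _ _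

lemma relationsGenerated_of_fibreProduct {N : Type u} {W : ModuleCat.{u} A} [AddCommGroup N]
    [Module A N] {m : ℕ} (δ : Ext (residue 𝒜) W m)
    (hδ : ∀ (i : ℕ) (y : Ext W (residue 𝒜) (i + 1)), δ.comp y rfl = 0 → y = 0)
    {κ : Type u} [Fintype κ] [DecidableEq κ] {c : N →ₗ[A] W}
    (hc : Function.Surjective c) (pr : κ → (N →ₗ[A] A)) (ψ : κ → (W ⟶ residue 𝒜))
    (hψ : ∀ k x, (ψ k).hom (c x) = (irrel 𝒜).mkQ (pr k x)) (inc : κ → (irrel 𝒜 →ₗ[A] N))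
    (hcinc : ∀ k y, c (inc k y) = 0)
    (hprinc : ∀ j k y, pr j (inc k y) = if j = k then (y : A) else 0)
    (hker : ∀ x, c x = 0 → ∀ y : κ → irrel 𝒜, (∀ k, (y k : A) = pr k x) → ∑ k, inc k (y k) = x)
    {d : ℕ} (hN : ∀ i, d ≤ i → ExtGenerated 𝒜 (ModuleCat.of A N) i) :
    RelationsGenerated (yonedaDeg (residue 𝒜)) fun k =>
      DirectSum.of (SelfExt (residue 𝒜)) m (δ.comp (Ext.mk₀ (ψ k)) (add_zero m)) :=
  relationsGenerated_yoneda δ hδ ψ ⟨d, fun i hi b hb =>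
    exists_reduced_relations hc pr (fun k => (ψ k).hom) hψ inc hcinc hprinc hker (hN i hi) b hb⟩

include hdeg h_zero in
theorem isLeftGradedCoherent_koszulDual [Module.Finite K (𝒜 1)]
    (h_ld : ∀ M : GrMod 𝒜, Module.Finite A M.carrier → linearityDefect M < ⊤) :
    IsLeftGradedCoherent (koszulDualDeg 𝒜) := by
  classical
  have hmin := GradedFreeResolution.isMinimal_of_linear hdeg
  refine isLeftGradedCoherent_of_relations (scalarHom 𝒜) (fun c => ⟨_, rfl⟩) ?_ ?_ ?_
  · intro n
    obtain ⟨r, w, hw⟩ := P.exists_ext_generators h_zero n 0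
    refine ⟨r, fun j => DirectSum.of (SelfExt (residue 𝒜)) n (w j), fun j => ⟨_, rfl⟩, ?_⟩
    rintro _ ⟨x, rfl⟩
    obtain ⟨c, hc⟩ := hw x
    refine ⟨c, ?_⟩
    refine (congrArg (DirectSum.of (SelfExt (residue 𝒜)) n) hc).trans ((of_sum _).trans ?_)
    exact Finset.sum_congr rfl fun j _ => of_comp _ _ _
  · rintro n _ ⟨x, rfl⟩
    obtain ⟨r, g, ξ, h⟩ := hmin.extGenerated_syz h_zero n 0
      (GradedFreeResolution.not_linHomologyNeZero hdeg _) x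
    refine ⟨r, fun k => DirectSum.of (SelfExt (residue 𝒜)) 1 (ξ k),
      fun k => DirectSum.of (SelfExt (residue 𝒜)) n (g k), fun k => ⟨_, rfl⟩,
      fun k => ⟨_, rfl⟩, ?_⟩
    refine (congrArg (DirectSum.of (SelfExt (residue 𝒜)) (n + 1)) h).trans ((of_sum _).trans ?_)
    exact Finset.sum_congr rfl fun j _ => of_comp _ _ _
  · intro n hn κ _ u hu
    -- In positive degree `n + 1` the syzygy in question is the image of `P.d n`, a submodule of a
    -- free module, as the fibre product requires.
    obtain ⟨n, rfl⟩ : ∃ m, n = m + 1 := ⟨n - 1, by omega⟩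
    obtain ⟨δ, hδ₁, hδ₂⟩ :
      ∃ δ : Ext (residue 𝒜) (ModuleCat.of A (LinearMap.range (P.d n))) (n + 1),
        (∀ x : Ext (residue 𝒜) (residue 𝒜) (n + 1),
          ∃ y : Ext (ModuleCat.of A (LinearMap.range (P.d n))) (residue 𝒜) 0,
            δ.comp y (add_zero _) = x) ∧
        ∀ (i : ℕ) (y : Ext (ModuleCat.of A (LinearMap.range (P.d n))) (residue 𝒜) (i + 1)),
          δ.comp y rfl = 0 → y = 0 := by
      obtain ⟨δ, h1, h2⟩ := P.exists_syzClass_iterate (n + 1)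
      exact ⟨δ, h1 _ 0 _ _, fun i => h2 _ i _ rfl⟩
    have hψ : ∀ k, ∃ ψ : ModuleCat.of A (LinearMap.range (P.d n)) ⟶ residue 𝒜,
        u k = DirectSum.of (SelfExt (residue 𝒜)) (n + 1)
          (δ.comp (Ext.mk₀ ψ) (add_zero _)) := fun k => by
      obtain ⟨v, hv⟩ := hu k
      obtain ⟨f, rfl⟩ := hδ₁ v
      obtain ⟨ψ, rfl⟩ := (Ext.mk₀_bijective _ _).2 f
      exact ⟨ψ, hv.symm⟩
    choose ψ hψ using hψ
    obtain rfl := funext hψ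
    obtain ⟨N, c, pr, inc, hN, hc, h1, h2, h3, h4⟩ :=
      exists_fibreProduct P hdeg h_zero n fun k => (ψ k).hom
    -- The finiteness of the linearity defect enters only here, for the fibre product `N`.
    obtain ⟨Q, hQ, d, hd⟩ := exists_isMinimal_of_linearityDefect_lt_top (h_ld N hN)
    exact relationsGenerated_of_fibreProduct δ hδ₂ hc pr ψ h1 inc h2 h3 h4 (d := d) fun i hi =>
      hQ.extGenerated_syz h_zero i 0 (hd _ (by omega))

end KoszulDualCoherent

end

end KoszulLD

theorem proposition4p7 {K : Type v} {A : Type u} [Field K] [Ring A] [Algebra K A]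
    (𝒜 : ℕ → Submodule K A) [GradedAlgebra 𝒜]
    (h_zero : Function.Bijective (algebraMap K (𝒜 0)))
    (h_fin : ∀ i, Module.Finite K (𝒜 i))
    (h_koszul : KoszulLD.IsKoszul 𝒜)
    (h_ld : ∀ M : KoszulLD.GrMod 𝒜, Module.Finite A M.carrier → KoszulLD.linearityDefect M < ⊤) :
    KoszulLD.IsLeftGradedCoherent (KoszulLD.koszulDualDeg 𝒜) ∧
    Nonempty (Abelian (KoszulLD.isFP (KoszulLD.koszulDualDeg 𝒜)).FullSubcategory) ∧
    PreservesFiniteLimits (KoszulLD.isFP (KoszulLD.koszulDualDeg 𝒜)).ι ∧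
    PreservesFiniteColimits (KoszulLD.isFP (KoszulLD.koszulDualDeg 𝒜)).ι := by
  obtain ⟨P, hP, hdeg⟩ := h_koszul
  have := h_fin 1
  have h := KoszulLD.isLeftGradedCoherent_koszulDual P hdeg h_zero h_ld
  exact ⟨h, KoszulLD.abelian_isFP h⟩
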